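/- **Theorem (Heteroscedastic Catoni Estimation with Function Approximation).** *Notation.* $\mathcal{B}^n$ is the closed Euclidean unit ball of $\mathbb{R}^n$, $\|x\|_A=\sqrt{x^\top A x}$, and $\mathsf{logs}(x_1,\dots,x_n)=\sum_{i=1}^n\log(e+x_i)$. Let $\psi(y)=\log(1+y+y^2)$ for $y\ge 0$ and $\psi(y)=-\log(1-y+y^2)$ for $y<0$. For $T\ge1$, the Catoni estimate of real data $X_1,\dots,X_T$ with parameter $\alpha>0$ is the unique root $z$ of $\sum_{t=1}^T\psi(\alpha(X_t-z))$. *Setting.* Let $d,d',p,T\in\mathbb{N}$, $H,\beta_u,\beta_\mu,\beta_\eta\ge 0$ and $R,\sigma_{\min}>0$. Let $(\mathcal{F}_t)_{t\ge0}$ be a filtration on a probability space, and for $1\le t\le T$ let $\phi_t\in\mathbb{R}^d$ and $\sigma_t\in\mathbb{R}$ be $\mathcal{F}_{t-1}$-measurable, and $\phi'_t\in\mathbb{R}^{d'}$ and $\eta_t\in\mathbb{R}$ be $\mathcal{F}_t$-measurable. Assume that almost surely, for all $t$, $\|\phi_t\|_2,\|\phi'_t\|_2\le1$, $|\eta_t|\le\beta_\eta$,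 $\sigma_t\ge\sigma_{\min}$, and that: 1. there is an $\mathbb{R}^d$-valued signed measure $\mu$ on $\mathcal{B}^{d'}$, whose vector $|\mu|(\mathcal{B}^{d'})$ of coordinatewise total variations satisfies $\||\mu|(\mathcal{B}^{d'})\|_2\le\beta_\mu$, such that for all bounded measurable $f$ and all $t$, $\mathbb{E}[f(\phi'_t)\mid\mathcal{F}_{t-1}]=\langle\phi_t,\int f\,d\mu\rangle$ almost surely; 2. $\mathbb{E}[\eta_t\mid\mathcal{F}_{t-1}]=0$ for all $t$; 3. $u_\star\in\mathbb{R}^d$ with $\|u_\star\|_2\le\beta_u$, $\mathscr{F}$ is a class of measurable functions $\mathbb{R}^{d'}\to[-H,H]$, $f_\star\in\mathscr{F}$ is random (it may depend on all the data), and almost surely $y_t=\langle u_\star,\phi_t\rangle+f_\star(\phi'_t)+\eta_t$ for all $t$; 4. almost surely, for all $t$, $\mathbb{E}\big[(\langle\phi_t,u_\star\rangle+f(\phi'_t)+\eta_t)^2\mid\mathcal{F}_{t-1}\big]\big|_{f=f_\star}\le\frac12\sigma_t^2$, where the conditional expectation is computed for a fixed function $f$ (through the regular conditional law of $(\phi'_t,\eta_t)$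 given $\mathcal{F}_{t-1}$) and the realized $f_\star$ is then inserted; 5. for every $\epsilon>0$, the $\epsilon$-covering number of $\mathscr{F}$ (minimal cardinality of an $\epsilon$-net contained in $\mathscr{F}$) in the metric $\mathrm{dist}_\infty(f,g)=\sup_{x\in\mathcal{B}^{d'}}|f(x)-g(x)|$ is finite, with logarithm at most $p\log(1+2R/\epsilon)$. Put $\theta_\star=u_\star+\int f_\star\,d\mu$. For $\lambda,\alpha_{\max}>0$ let $\Sigma_T=\sum_{t=1}^T\sigma_t^{-2}\phi_t\phi_t^\top$, $\Lambda_T=\lambda I+\Sigma_T$ and $$d_T=c\,(p+d)\,\mathsf{logs}\big(T,\alpha_{\max}^2,\lambda^{-1},\sigma_{\min}^{-2},\beta_\mu,\beta_u,\beta_\eta,R,H\big).$$ For $v\in\mathbb{R}^d$ let $\mathsf{cat}[T\Lambda_T^{-1}v]$ denote the Catoni estimate of the data and with the parameter $$X_t=\frac{T\,v^\top\Lambda_T^{-1}\phi_t\,y_t}{\sigma_t^2},\qquad \alpha=\min\Big\{\sqrt{\|T\Lambda_T^{-1}v\|_{\Sigma_T}^{-2}\,(d_T+\log\tfrac1\delta)},\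 \alpha_{\max}\Big\},$$ where $\alpha=\alpha_{\max}$ if $\|T\Lambda_T^{-1}v\|_{\Sigma_T}=0$. *Claim.* There is a universal constant $c>0$ such that in every such setting, for all $\lambda,\alpha_{\max}>0$ and $\delta\in(0,1)$ with $T\ge 6(\log\frac1\delta+d_T)$, with probability at least $1-\delta$, simultaneously for all $v\in\mathcal{B}^d$, $$\big|\mathsf{cat}[T\Lambda_T^{-1}v]-v^\top\theta_\star\big|\le 5\|v\|_{\Lambda_T^{-1}}\Big(\sqrt{\log\tfrac1\delta+d_T}+\sqrt\lambda\,\|\theta_\star\|_2\Big)+\frac{3(\log\frac1\delta+d_T)}{\alpha_{\max}T}.$$ -/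

import Mathlib

open MeasureTheory
open scoped ENNReal NNReal

namespace HeteroCatoni

/-! ### The Catoni estimator -/

/-- The influence function `ψ(y) = log (1 + y + y²)` for `y ≥ 0` and `-log (1 - y + y²)`
for `y < 0`. -/
noncomputable def psi (y : ℝ) : ℝ :=
  if 0 ≤ y then Real.log (1 + y + y ^ 2) else -Real.log (1 - y + y ^ 2)

/-- `f(z; X, α) = ∑ₜ ψ(α (Xₜ - z))`. -/
noncomputable def catoniFun {T : ℕ} (X : Fin T → ℝ) (α z : ℝ) : ℝ :=
  ∑ t, psi (α * (X t - z))

/-- The Catoni estimate of the data `X` with parameter `α`: the root `z` of `f(z; X, α)`, which is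
unique when `T ≥ 1` and `α > 0` by `catoniFun_existsUnique_root`. -/
noncomputable def catoni {T : ℕ} (X : Fin T → ℝ) (α : ℝ) : ℝ :=
  Classical.epsilon fun z => catoniFun X α z = 0

theorem psi_zero : psi 0 = 0 := by simp [psi]

theorem psi_neg (y : ℝ) : psi (-y) = -psi y := by
  unfold psi
  rcases lt_trichotomy y 0 with h | h | h
  · rw [if_pos (by linarith), if_neg (by linarith), neg_neg]
    congr 1
    ring
  · subst h; simp
  · rw [if_neg (by linarith), if_pos h.le]
    congr 2
    ring

theorem psi_continuous : Continuous psi := by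
  unfold psi
  refine Continuous.if_le ?_ ?_ continuous_const continuous_id ?_
  · exact Continuous.log (by fun_prop) fun y => by nlinarith [sq_nonneg (y + 1 / 2)]
  · exact (Continuous.log (by fun_prop) fun y => by nlinarith [sq_nonneg (y - 1 / 2)]).neg
  · intro y hy
    simp [← hy]

theorem psi_strictMono : StrictMono psi := by
  have key : ∀ a b : ℝ, 0 ≤ a → a < b → psi a < psi b := by
    intro a b ha hab
    unfold psi
    rw [if_pos ha, if_pos (ha.trans hab.le)]
    exact Real.log_lt_log (by positivity) (by nlinarith)
  intro a b hab
  rcases le_or_gt 0 a with ha | ha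
  · exact key a b ha hab
  · rcases le_or_gt b 0 with hb | hb
    · have := key (-b) (-a) (by linarith) (by linarith)
      rw [psi_neg, psi_neg] at this
      linarith
    · have h1 := key 0 b le_rfl hb
      have h2 := key 0 (-a) le_rfl (by linarith)
      rw [psi_neg, psi_zero] at h2
      rw [psi_zero] at h1
      linarith

theorem catoniFun_existsUnique_root {T : ℕ} (hT : 0 < T) (X : Fin T → ℝ) {α : ℝ} (hα : 0 < α) :
    ∃! z, catoniFun X α z = 0 := by
  have : Nonempty (Fin T) := ⟨⟨0, hT⟩⟩
  have hanti : StrictAnti (catoniFun X α) := by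
    intro a b hab
    refine Finset.sum_lt_sum_of_nonempty Finset.univ_nonempty fun t _ => psi_strictMono ?_
    exact mul_lt_mul_of_pos_left (by linarith) hα
  have hcont : Continuous (catoniFun X α) := by
    unfold catoniFun
    exact continuous_finsetSum _ fun t _ => psi_continuous.comp (by fun_prop)
  obtain ⟨i, hi⟩ := Finite.exists_min X
  obtain ⟨j, hj⟩ := Finite.exists_max X
  have h1 : 0 ≤ catoniFun X α (X i) := by
    refine Finset.sum_nonneg fun t _ => ?_
    rw [← psi_zero]
    exact psi_strictMono.monotone (mul_nonneg hα.le (sub_nonneg.2 (hi t)))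
  have h2 : catoniFun X α (X j) ≤ 0 := by
    refine Finset.sum_nonpos fun t _ => ?_
    rw [← psi_zero]
    exact psi_strictMono.monotone (mul_nonpos_of_nonneg_of_nonpos hα.le (sub_nonpos.2 (hj t)))
  obtain ⟨z, -, hz⟩ := intermediate_value_Icc' (hi j) hcont.continuousOn ⟨h2, h1⟩
  exact ⟨z, hz, fun w hw => hanti.injective (hw.trans hz.symm)⟩

/-! ### Vectors, matrices and the effective dimension -/

/-- `‖x‖_A = √(xᵀ A x)`. -/
noncomputable def weightedNorm {d : ℕ} (A : Matrix (Fin d) (Fin d) ℝ)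
    (x : EuclideanSpace ℝ (Fin d)) : ℝ :=
  √(x.ofLp ⬝ᵥ A.mulVec x.ofLp)

/-- `Σ_T = ∑ₜ σₜ⁻² φₜ φₜᵀ`. -/
noncomputable def sigmaMatrix {d T : ℕ} (φ : Fin T → EuclideanSpace ℝ (Fin d)) (σ : Fin T → ℝ) :
    Matrix (Fin d) (Fin d) ℝ :=
  ∑ t, ((σ t) ^ 2)⁻¹ • Matrix.vecMulVec (φ t).ofLp (φ t).ofLp

/-- `Λ_T = λ I + ∑ₜ σₜ⁻² φₜ φₜᵀ`. -/
noncomputable def lambdaMatrix {d T : ℕ} (lam : ℝ) (φ : Fin T → EuclideanSpace ℝ (Fin d))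
    (σ : Fin T → ℝ) : Matrix (Fin d) (Fin d) ℝ :=
  lam • (1 : Matrix (Fin d) (Fin d) ℝ) + sigmaMatrix φ σ

/-- The direction `T Λ_T⁻¹ v`. -/
noncomputable def direction {d T : ℕ} (lam : ℝ) (φ : Fin T → EuclideanSpace ℝ (Fin d))
    (σ : Fin T → ℝ) (v : EuclideanSpace ℝ (Fin d)) : EuclideanSpace ℝ (Fin d) :=
  WithLp.toLp 2 ((T : ℝ) • (lambdaMatrix lam φ σ)⁻¹.mulVec v.ofLp)

/-- `logs (x₁, …, xₙ) = ∑ᵢ log (e + xᵢ)`. -/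
noncomputable def logs (xs : List ℝ) : ℝ :=
  (xs.map fun x => Real.log (Real.exp 1 + x)).sum

/-- `d_T = c (p + d) logs (T, α_max², λ⁻¹, σ_min⁻², β_μ, β_u, β_η, R, H)`. -/
noncomputable def effDim (c : ℝ) (p d T : ℕ) (αmax lam σmin βμ βu βη R H : ℝ) : ℝ :=
  c * ((p : ℝ) + d) *
    logs [(T : ℝ), αmax ^ 2, lam⁻¹, (σmin ^ 2)⁻¹, βμ, βu, βη, R, H]

/-- The Catoni parameter `min {√(‖w‖_{Σ_T}⁻² L), α_max}`, where `‖w‖_{Σ_T}⁻² = ∞`, hence the minimum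
is `α_max`, if `‖w‖_{Σ_T} = 0`. -/
noncomputable def catoniParam {d : ℕ} (S : Matrix (Fin d) (Fin d) ℝ) (L αmax : ℝ)
    (w : EuclideanSpace ℝ (Fin d)) : ℝ :=
  if weightedNorm S w = 0 then αmax else min (√((weightedNorm S w ^ 2)⁻¹ * L)) αmax

/-- The estimate `cat[w]`: the Catoni estimate with parameter `α` of the scalar data
`Xₜ = wᵀ φₜ yₜ / σₜ²`. -/
noncomputable def catoniDir {d T : ℕ} (φ : Fin T → EuclideanSpace ℝ (Fin d)) (y σ : Fin T → ℝ)
    (α : ℝ) (w : EuclideanSpace ℝ (Fin d)) : ℝ :=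
  catoni (fun t => inner ℝ w (φ t) * y t / (σ t) ^ 2) α

/-! ### The regression setting -/

/-- The unit ball of `ℝⁿ`. -/
abbrev UnitBall (n : ℕ) : Set (EuclideanSpace ℝ (Fin n)) :=
  Metric.closedBall 0 1

/-- `∫ f dμ ∈ ℝᵈ` for an `ℝᵈ`-valued signed measure `μ = (μ₁, …, μ_d)` over the unit ball. -/
noncomputable def vecIntegral {d d' : ℕ} (μ : Fin d → SignedMeasure (UnitBall d'))
    (f : EuclideanSpace ℝ (Fin d') → ℝ) : EuclideanSpace ℝ (Fin d) :=
  WithLp.toLp 2 fun i => ∫ᵛ x, f (x : EuclideanSpace ℝ (Fin d')) ∂<•(μ i)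

/-- `|μ|(B) ∈ ℝᵈ`, the vector of the total variations of the coordinates. -/
noncomputable def totalMass {d d' : ℕ} (μ : Fin d → SignedMeasure (UnitBall d')) :
    EuclideanSpace ℝ (Fin d) :=
  WithLp.toLp 2 fun i => (μ i).totalVariation.real Set.univ

/-- The `ε`-covering number of a class of functions on `ℝⁿ` for the distance
`dist∞ (f, g) = sup {|f x - g x| : x in the unit ball}`. -/
noncomputable def supCoveringNumber {n : ℕ} (F : Set (EuclideanSpace ℝ (Fin n) → ℝ)) (ε : ℝ≥0) :
    ℕ∞ :=
  Metric.coveringNumber ε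
    ((fun f : EuclideanSpace ℝ (Fin n) → ℝ => UniformFun.ofFun ((UnitBall n).domRestrict f)) '' F)

/-- The regular conditional distribution of `Z` given the sub-`σ`-algebra `m`, at `ω`. -/
noncomputable def condLaw {Ω S : Type*} (m : MeasurableSpace Ω) [mΩ : MeasurableSpace Ω]
    [MeasurableSpace S] [StandardBorelSpace S] [Nonempty S] (P : Measure Ω) [IsFiniteMeasure P]
    (Z : Ω → S) (ω : Ω) : Measure S :=
  (@ProbabilityTheory.condDistrib Ω Ω S _ _ _ mΩ m Z id P _) ω

/-- Heteroscedastic regression with function approximation. The index `t : Fin T` stands for the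
time `t + 1 ∈ {1, …, T}`, so that `ℱ t` is the past of that time and `ℱ (t + 1)` its present.
`fstar ω` is the realization of the data-dependent function; nothing is required of its dependence
on `ω`. Conditional expectations of expressions in it are taken with `fstar` held fixed. -/
structure IsRegression {Ω : Type*} [mΩ : MeasurableSpace Ω] (P : Measure Ω)
    [IsProbabilityMeasure P] (ℱ : Filtration ℕ mΩ) {d d' T : ℕ} (p : ℕ)
    (H βu βμ βη σmin R : ℝ)
    (φ : Fin T → Ω → EuclideanSpace ℝ (Fin d)) (φ' : Fin T → Ω → EuclideanSpace ℝ (Fin d'))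
    (y η σ : Fin T → Ω → ℝ) (μ : Fin d → SignedMeasure (UnitBall d'))
    (ustar : EuclideanSpace ℝ (Fin d)) (F : Set (EuclideanSpace ℝ (Fin d') → ℝ))
    (fstar : Ω → EuclideanSpace ℝ (Fin d') → ℝ) : Prop where
  /-- Measurability with respect to the filtration. -/
  measurable_feature : ∀ t : Fin T, Measurable[ℱ (t : ℕ)] (φ t)
  measurable_feature' : ∀ t : Fin T, Measurable[ℱ ((t : ℕ) + 1)] (φ' t)
  measurable_noise : ∀ t : Fin T, Measurable[ℱ ((t : ℕ) + 1)] (η t)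
  measurable_sigma : ∀ t : Fin T, Measurable[ℱ (t : ℕ)] (σ t)
  norm_feature_le : ∀ᵐ ω ∂P, ∀ t : Fin T, ‖φ t ω‖ ≤ 1
  norm_feature'_le : ∀ᵐ ω ∂P, ∀ t : Fin T, ‖φ' t ω‖ ≤ 1
  /-- The conditional law of `φ'` is linear in `φ`. -/
  totalMass_le : ‖totalMass μ‖ ≤ βμ
  condExp_eq : ∀ f : EuclideanSpace ℝ (Fin d') → ℝ, Measurable f → (∃ C, ∀ x, |f x| ≤ C) →
    ∀ t : Fin T, P[fun ω => f (φ' t ω) | ℱ (t : ℕ)] =ᵐ[P] fun ω => inner ℝ (φ t ω) (vecIntegral μ f)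
  /-- The noise is bounded and conditionally centred. -/
  noise_le : ∀ᵐ ω ∂P, ∀ t : Fin T, |η t ω| ≤ βη
  noise_condExp : ∀ t : Fin T, P[η t | ℱ (t : ℕ)] =ᵐ[P] 0
  /-- The targets. -/
  norm_ustar_le : ‖ustar‖ ≤ βu
  class_measurable : ∀ f ∈ F, Measurable f
  class_bounded : ∀ f ∈ F, ∀ x, |f x| ≤ H
  fstar_mem : ∀ ω, fstar ω ∈ F
  target_eq : ∀ᵐ ω ∂P, ∀ t : Fin T, y t ω = inner ℝ ustar (φ t ω) + fstar ω (φ' t ω) + η t ω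
  /-- The variance bounds: `E[(⟨φₜ, u⋆⟩ + f⋆(φ'ₜ) + ηₜ)² | ℱₜ₋₁] ≤ σₜ² / 2` with `f⋆` held fixed. -/
  sigma_ge : ∀ᵐ ω ∂P, ∀ t : Fin T, σmin ≤ σ t ω
  variance_le : ∀ᵐ ω ∂P, ∀ t : Fin T,
    ∫ z, (inner ℝ (φ t ω) ustar + fstar ω z.1 + z.2) ^ 2
      ∂(condLaw (ℱ (t : ℕ)) P (fun ω' => (φ' t ω', η t ω')) ω) ≤ 1 / 2 * (σ t ω) ^ 2
  /-- The class is parametric: `log N(F, dist∞, ε) ≤ p log (1 + 2 R / ε)`. -/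
  covering : ∀ ε : ℝ≥0, 0 < ε → ∃ N : ℕ, supCoveringNumber F ε = N ∧
    Real.log N ≤ p * Real.log (1 + 2 * R / ε)

end HeteroCatoni

open HeteroCatoni

namespace HeteroCatoni

/-! ### The influence function and the estimator -/

/-! The weights `T Λ_T⁻¹ v`, the parameter `α` and `f⋆` all depend on the whole sample, so no
martingale bound applies to the estimator itself. Put `a = α T Λ_T⁻¹ v` and `b = α z`: the
influences become `ψ(σₜ⁻²⟨a, φₜ⟩ yₜ - b)`, and it suffices to control their sum uniformly over
deterministic `(a, b, f)`.

For fixed `(a, b, f)`, let `Zₜ` be the argument of `ψ`. Since `exp ψ(Z) ≤ 1 + Z + Z²`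
(`exp_psi_le`), the exponential of `∑ₜ (ψ(Zₜ) - E[Zₜ + Zₜ² | past])` has expectation at most one
(`IsRegression.lintegral_exp_logSupermartingale_le_one`). The linear conditional law identifies the
conditional mean of the response as `⟨φₜ, u⋆ + ∫ f dμ⟩`. Markov's inequality and a union bound over
a finite net cost the logarithm of its cardinality, which `d_T` absorbs. All terms are Lipschitz in
`(a, b, f)` with constants polynomial in `S = exp logs(…)`, so a net of scale a negative power of
`S` loses at most 1 in total. Only then are `f⋆` and its variance bound inserted
(`IsRegression.exists_uniform_bound`).

The rest is deterministic. Let `L = log(1/δ) + d_T` and `m = ∑ₜ σₜ⁻²⟨Λ_T⁻¹ v, φₜ⟩⟨φₜ, θ⋆⟩`. At `z =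
m + 3L/(αT)` the linear terms contribute `-3L`, the variances at most `L/2` because `α² ‖T Λ_T⁻¹
v‖²_Σ ≤ L`, and the squared shift at most `3L/2` because `6L ≤ T`. The total `-L` beats the
deviation (`sum_meanBound_le`), so by monotonicity the root lies below `z`; replacing `(a, b)` by
the pair built from `-α` bounds it from the other side. The choice of `α` controls `3L/(αT)`, and
`m` differs from `vᵀθ⋆` by the ridge bias `λ⟨Λ_T⁻¹ v, θ⋆⟩` (`abs_catoniDir_sub_le`). -/

theorem exp_psi_le (y : ℝ) : Real.exp (psi y) ≤ 1 + y + y ^ 2 := by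
  unfold psi
  split_ifs with h
  · rw [Real.exp_log (by positivity)]
  · have h1 : 0 < 1 - y + y ^ 2 := by nlinarith
    rw [Real.exp_neg, Real.exp_log h1, inv_le_comm₀ h1 (by nlinarith [sq_nonneg (y + 1 / 2)]),
      inv_le_iff_one_le_mul₀ (by nlinarith [sq_nonneg (y + 1 / 2)])]
    -- `(1 + y + y²)(1 - y + y²) = 1 + y² + y⁴ ≥ 1`.
    nlinarith [sq_nonneg y, sq_nonneg (y ^ 2)]

theorem psi_sub_le_of_nonneg {a b : ℝ} (ha : 0 ≤ a) (hab : a ≤ b) :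
    psi b - psi a ≤ 2 * (b - a) := by
  have hb := ha.trans hab
  obtain ⟨h, rfl⟩ : ∃ h, b = a + h := ⟨b - a, by ring⟩
  have hh : 0 ≤ h := by linarith
  rw [psi, psi, if_pos ha, if_pos hb, sub_le_iff_le_add,
    Real.log_le_iff_le_exp (by positivity), Real.exp_add, Real.exp_log (by positivity)]
  have h1 := Real.quadratic_le_exp_of_nonneg (x := 2 * (a + h - a)) (by linarith)
  have h2 : 0 ≤ a * h := by positivity
  have h3 : 0 ≤ a ^ 2 * h := by positivity
  calc 1 + (a + h) + (a + h) ^ 2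
      ≤ (1 + 2 * (a + h - a) + (2 * (a + h - a)) ^ 2 / 2) * (1 + a + a ^ 2) := by
        have : 0 ≤ a * h ^ 2 := by positivity
        have : 0 ≤ a ^ 2 * h ^ 2 := by positivity
        nlinarith
    _ ≤ _ := by gcongr

theorem psi_sub_le_of_le {a b : ℝ} (hab : a ≤ b) : psi b - psi a ≤ 2 * (b - a) := by
  rcases le_total 0 a with ha | ha
  · exact psi_sub_le_of_nonneg ha hab
  · rcases le_total b 0 with hb | hb
    · have := psi_sub_le_of_nonneg (a := -b) (b := -a) (by linarith) (by linarith)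
      rw [psi_neg, psi_neg] at this
      linarith
    · have h1 := psi_sub_le_of_nonneg le_rfl hb
      have h2 := psi_sub_le_of_nonneg (a := 0) (b := -a) le_rfl (by linarith)
      rw [psi_neg, psi_zero] at h2
      rw [psi_zero] at h1
      linarith

/-- The Lipschitz bound that moves the influences from a net point to nearby parameters; the
constant is not optimal. -/
theorem psi_sub_le (a b : ℝ) : psi b - psi a ≤ 2 * |b - a| := by
  rcases le_total a b with h | h
  · exact (psi_sub_le_of_le h).trans (by gcongr; exact le_abs_self _)
  · have := psi_strictMono.monotone h
    have := abs_nonneg (b - a)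
    linarith

theorem catoniFun_catoni {T : ℕ} (hT : 0 < T) (X : Fin T → ℝ) {α : ℝ} (hα : 0 < α) :
    catoniFun X α (catoni X α) = 0 :=
  Classical.epsilon_spec (catoniFun_existsUnique_root hT X hα).exists

theorem catoniFun_strictAnti {T : ℕ} (hT : 0 < T) (X : Fin T → ℝ) {α : ℝ} (hα : 0 < α) :
    StrictAnti (catoniFun X α) := by
  have : Nonempty (Fin T) := ⟨⟨0, hT⟩⟩
  intro a b hab
  refine Finset.sum_lt_sum_of_nonempty Finset.univ_nonempty fun t _ => psi_strictMono ?_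
  exact mul_lt_mul_of_pos_left (by linarith) hα

theorem catoni_le {T : ℕ} (hT : 0 < T) (X : Fin T → ℝ) {α z : ℝ} (hα : 0 < α)
    (h : ∑ t, psi (α * X t - α * z) ≤ 0) : catoni X α ≤ z := by
  rw [← (catoniFun_strictAnti hT X hα).le_iff_ge, catoniFun_catoni hT X hα]
  simpa only [catoniFun, mul_sub] using h

/-- As `ψ` is odd, the lower bound has the same form as the upper one with `α` replaced by `-α`, so
one uniform inequality serves both. -/
theorem le_catoni {T : ℕ} (hT : 0 < T) (X : Fin T → ℝ) {α z : ℝ} (hα : 0 < α)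
    (h : ∑ t, psi (-(α * X t) - -(α * z)) ≤ 0) : z ≤ catoni X α := by
  rw [← (catoniFun_strictAnti hT X hα).le_iff_ge, catoniFun_catoni hT X hα]
  have h2 : ∀ t, psi (-(α * X t) - -(α * z)) = - psi (α * (X t - z)) := fun t => by
    rw [← psi_neg]; congr 1; ring
  simp only [h2, Finset.sum_neg_distrib] at h
  unfold catoniFun
  linarith

/-! ### Quadratic forms -/

theorem dotProduct_sigmaMatrix_mulVec {d T : ℕ} (φ : Fin T → EuclideanSpace ℝ (Fin d))
    (σ : Fin T → ℝ) (a x : EuclideanSpace ℝ (Fin d)) :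
    a.ofLp ⬝ᵥ (sigmaMatrix φ σ).mulVec x.ofLp
      = ∑ t, ((σ t) ^ 2)⁻¹ * inner ℝ a (φ t) * inner ℝ x (φ t) := by
  have hin : ∀ u w : EuclideanSpace ℝ (Fin d), inner ℝ u w = w.ofLp ⬝ᵥ u.ofLp := fun u w => by
    simp [EuclideanSpace.inner_eq_star_dotProduct]
  simp only [sigmaMatrix, Matrix.sum_mulVec, dotProduct_sum, Matrix.smul_mulVec,
    Matrix.vecMulVec_mulVec, hin]
  refine Finset.sum_congr rfl fun t _ => ?_
  simp [smul_eq_mul, dotProduct_comm a.ofLp]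
  ring

theorem dotProduct_lambdaMatrix_mulVec {d T : ℕ} (lam : ℝ) (φ : Fin T → EuclideanSpace ℝ (Fin d))
    (σ : Fin T → ℝ) (a x : EuclideanSpace ℝ (Fin d)) :
    a.ofLp ⬝ᵥ (lambdaMatrix lam φ σ).mulVec x.ofLp
      = lam * inner ℝ a x + ∑ t, ((σ t) ^ 2)⁻¹ * inner ℝ a (φ t) * inner ℝ x (φ t) := by
  rw [lambdaMatrix, Matrix.add_mulVec, dotProduct_add, dotProduct_sigmaMatrix_mulVec,
    Matrix.smul_mulVec, Matrix.one_mulVec, dotProduct_smul, smul_eq_mul]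
  congr 2
  simp [EuclideanSpace.inner_eq_star_dotProduct, dotProduct_comm]

theorem isUnit_det_lambdaMatrix {d T : ℕ} {lam : ℝ} (hlam : 0 < lam)
    (φ : Fin T → EuclideanSpace ℝ (Fin d)) (σ : Fin T → ℝ) :
    IsUnit (lambdaMatrix lam φ σ).det := by
  rw [← Matrix.isUnit_iff_isUnit_det, ← Matrix.mulVec_injective_iff_isUnit]
  change Function.Injective (Matrix.mulVecLin (lambdaMatrix lam φ σ))
  rw [injective_iff_map_eq_zero]
  intro x hx
  have h := dotProduct_lambdaMatrix_mulVec lam φ σ (WithLp.toLp 2 x) (WithLp.toLp 2 x)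
  rw [Matrix.mulVecLin_apply] at hx
  rw [hx, dotProduct_zero, real_inner_self_eq_norm_sq] at h
  have h2 : 0 ≤ ∑ t, ((σ t) ^ 2)⁻¹ * inner ℝ (WithLp.toLp 2 x) (φ t)
      * inner ℝ (WithLp.toLp 2 x) (φ t) :=
    Finset.sum_nonneg fun t _ => by
      rw [mul_assoc]; exact mul_nonneg (by positivity) (mul_self_nonneg _)
  have h3 : ‖WithLp.toLp 2 x‖ ^ 2 = 0 := by nlinarith [sq_nonneg ‖WithLp.toLp 2 x‖]
  simpa using h3

/-- The vector `Λ⁻¹ v`, with the identities that the analysis of the estimator needs. -/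
theorem exists_lambdaMatrix_inv {d T : ℕ} {lam : ℝ} (hlam : 0 < lam)
    (φ : Fin T → EuclideanSpace ℝ (Fin d)) (σ : Fin T → ℝ) (v : EuclideanSpace ℝ (Fin d)) :
    ∃ x : EuclideanSpace ℝ (Fin d), direction lam φ σ v = (T : ℝ) • x ∧
      weightedNorm (lambdaMatrix lam φ σ)⁻¹ v ^ 2
        = lam * ‖x‖ ^ 2 + ∑ t, ((σ t) ^ 2)⁻¹ * inner ℝ x (φ t) ^ 2 ∧
      lam * ‖x‖ ≤ ‖v‖ ∧
      ∀ θ : EuclideanSpace ℝ (Fin d), inner ℝ v θ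
        = lam * inner ℝ x θ + ∑ t, ((σ t) ^ 2)⁻¹ * inner ℝ x (φ t) * inner ℝ (φ t) θ := by
  have hdet := isUnit_det_lambdaMatrix hlam φ σ
  set Λ := lambdaMatrix lam φ σ with hΛ
  let x : EuclideanSpace ℝ (Fin d) := WithLp.toLp 2 (Λ⁻¹.mulVec v.ofLp)
  have hx : Λ.mulVec x.ofLp = v.ofLp := by
    simp [x, Matrix.mulVec_mulVec, Matrix.mul_nonsing_inv _ hdet]
  have hθ : ∀ θ : EuclideanSpace ℝ (Fin d), inner ℝ v θ
        = lam * inner ℝ x θ + ∑ t, ((σ t) ^ 2)⁻¹ * inner ℝ x (φ t) * inner ℝ (φ t) θ := by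
    intro θ
    have h := dotProduct_lambdaMatrix_mulVec lam φ σ θ x
    rw [← hΛ, hx] at h
    have h' : inner ℝ v θ = θ.ofLp ⬝ᵥ v.ofLp := by
      simp [EuclideanSpace.inner_eq_star_dotProduct]
    rw [h', h, real_inner_comm]
    congr 1
    refine Finset.sum_congr rfl fun t _ => ?_
    rw [real_inner_comm (φ t) θ]
    ring
  have hxx : inner ℝ v x = lam * ‖x‖ ^ 2 + ∑ t, ((σ t) ^ 2)⁻¹ * inner ℝ x (φ t) ^ 2 := by
    rw [hθ x, real_inner_self_eq_norm_sq]
    congr 1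
    refine Finset.sum_congr rfl fun t _ => ?_
    rw [real_inner_comm x (φ t)]
    ring
  have hsum : 0 ≤ ∑ t, ((σ t) ^ 2)⁻¹ * inner ℝ x (φ t) ^ 2 :=
    Finset.sum_nonneg fun t _ => by positivity
  refine ⟨x, rfl, ?_, ?_, hθ⟩
  · have h : v.ofLp ⬝ᵥ Λ⁻¹.mulVec v.ofLp = inner ℝ v x := by
      simp [EuclideanSpace.inner_eq_star_dotProduct, x, dotProduct_comm]
    rw [weightedNorm, h, hxx, Real.sq_sqrt (by positivity)]
  · rcases (norm_nonneg x).eq_or_lt with h0 | h0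
    · simp [← h0]
    · have := real_inner_le_norm v x
      refine le_of_mul_le_mul_right ?_ h0
      nlinarith

theorem weightedNorm_sigmaMatrix_sq {d T : ℕ} (φ : Fin T → EuclideanSpace ℝ (Fin d))
    (σ : Fin T → ℝ) (w : EuclideanSpace ℝ (Fin d)) :
    weightedNorm (sigmaMatrix φ σ) w ^ 2 = ∑ t, ((σ t) ^ 2)⁻¹ * inner ℝ w (φ t) ^ 2 := by
  have h : w.ofLp ⬝ᵥ (sigmaMatrix φ σ).mulVec w.ofLp
      = ∑ t, ((σ t) ^ 2)⁻¹ * inner ℝ w (φ t) ^ 2 := by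
    rw [dotProduct_sigmaMatrix_mulVec]
    exact Finset.sum_congr rfl fun t _ => by ring
  rw [weightedNorm, h, Real.sq_sqrt (Finset.sum_nonneg fun t _ => by positivity)]

theorem catoniParam_pos {d : ℕ} (S : Matrix (Fin d) (Fin d) ℝ) {L αmax : ℝ} (hL : 0 < L)
    (hα : 0 < αmax) (w : EuclideanSpace ℝ (Fin d)) : 0 < catoniParam S L αmax w := by
  unfold catoniParam
  split_ifs with h
  · exact hα
  · have : 0 < weightedNorm S w := lt_of_le_of_ne (Real.sqrt_nonneg _) (Ne.symm h)
    exact lt_min (Real.sqrt_pos.2 (by positivity)) hα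

theorem catoniParam_le {d : ℕ} (S : Matrix (Fin d) (Fin d) ℝ) (L αmax : ℝ)
    (w : EuclideanSpace ℝ (Fin d)) : catoniParam S L αmax w ≤ αmax := by
  unfold catoniParam
  split_ifs with h
  · exact le_rfl
  · exact min_le_right _ _

/-- Keeps the summed variance proxy of the rescaled direction `α w` at most `L`. -/
theorem catoniParam_sq_mul_le {d : ℕ} (S : Matrix (Fin d) (Fin d) ℝ) {L αmax : ℝ} (hL : 0 < L)
    (hα : 0 < αmax) (w : EuclideanSpace ℝ (Fin d)) :
    catoniParam S L αmax w ^ 2 * weightedNorm S w ^ 2 ≤ L := by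
  have hpos := catoniParam_pos S hL hα w
  by_cases h : weightedNorm S w = 0
  · simp [h, hL.le]
  · have hw : 0 < weightedNorm S w := lt_of_le_of_ne (Real.sqrt_nonneg _) (Ne.symm h)
    have h1 : catoniParam S L αmax w ≤ √((weightedNorm S w ^ 2)⁻¹ * L) := by
      rw [catoniParam, if_neg h]; exact min_le_left _ _
    have h2 : catoniParam S L αmax w ^ 2 ≤ (weightedNorm S w ^ 2)⁻¹ * L := by
      rw [← Real.sq_sqrt (show 0 ≤ (weightedNorm S w ^ 2)⁻¹ * L by positivity)]
      gcongr
    calc _ ≤ (weightedNorm S w ^ 2)⁻¹ * L * weightedNorm S w ^ 2 := by gcongr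
      _ = L := by field_simp

/-- Each branch of the minimum accounts for exactly one of the two summands. -/
theorem div_catoniParam_le {d : ℕ} (S : Matrix (Fin d) (Fin d) ℝ) {L αmax : ℝ} (hL : 0 < L)
    (hα : 0 < αmax) (w : EuclideanSpace ℝ (Fin d)) :
    L / catoniParam S L αmax w ≤ √L * weightedNorm S w + L / αmax := by
  have hw : 0 ≤ weightedNorm S w := Real.sqrt_nonneg _
  have hLα : 0 ≤ L / αmax := by positivity
  unfold catoniParam
  split_ifs with h
  · rw [h]; simp
  · rcases min_choice √((weightedNorm S w ^ 2)⁻¹ * L) αmax with h1 | h1 <;> rw [h1]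
    · have hw : 0 < weightedNorm S w := lt_of_le_of_ne hw (Ne.symm h)
      have h2 : L / √((weightedNorm S w ^ 2)⁻¹ * L) = √L * weightedNorm S w := by
        rw [Real.sqrt_mul (by positivity), Real.sqrt_inv, Real.sqrt_sq hw.le,
          div_eq_iff (by positivity)]
        field_simp
        rw [Real.sq_sqrt hL.le]
      linarith
    · have : 0 ≤ √L * weightedNorm S w := by positivity
      linarith

/-! ### Disintegration along the regular conditional law -/

section CondLaw

theorem lintegral_condDistrib {α β S : Type*} {mα : MeasurableSpace α} {mβ : MeasurableSpace β}
    [MeasurableSpace S] [StandardBorelSpace S] [Nonempty S] (μ : Measure α) [IsFiniteMeasure μ]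
    {X : α → β} (hX : Measurable X) {Y : α → S} (hY : Measurable Y) {F : β × S → ℝ≥0∞}
    (hF : Measurable F) :
    ∫⁻ a, F (X a, Y a) ∂μ
      = ∫⁻ a, ∫⁻ y, F (X a, y) ∂(ProbabilityTheory.condDistrib Y X μ (X a)) ∂μ := by
  rw [← lintegral_map (f := F) hF (hX.prodMk hY),
    ← ProbabilityTheory.compProd_map_condDistrib hY.aemeasurable, Measure.lintegral_compProd hF,
    lintegral_map hF.lintegral_kernel_prod_right' hX]

theorem measurable_integral_condDistrib {α β S : Type*} {mα : MeasurableSpace α}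
    {mβ : MeasurableSpace β} [MeasurableSpace S] [StandardBorelSpace S] [Nonempty S]
    (μ : Measure α) [IsFiniteMeasure μ] (X : α → β) (Y : α → S) {F : β × S → ℝ}
    (hF : Measurable F) :
    Measurable fun x => ∫ y, F (x, y) ∂(ProbabilityTheory.condDistrib Y X μ x) :=
  hF.stronglyMeasurable.integral_condDistrib.measurable

variable {Ω S : Type*} {m mΩ : MeasurableSpace Ω} [MeasurableSpace S] [StandardBorelSpace S]
  [Nonempty S] {P : Measure Ω} [IsProbabilityMeasure P] {Z : Ω → S}

instance isProbabilityMeasure_condLaw (ω : Ω) : IsProbabilityMeasure (condLaw m P Z ω) := by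
  unfold condLaw
  infer_instance

/-- `condLaw` is the conditional distribution given the identity from `(Ω, mΩ)` to `(Ω, m)`. Hence
`F` may depend on the outcome only through `m`, and two `σ`-algebras on `Ω` have to be kept apart.
-/
theorem lintegral_condLaw (hm : m ≤ mΩ) (hZ : Measurable Z) {F : Ω → S → ℝ≥0∞}
    (hF : @Measurable _ _ (@Prod.instMeasurableSpace Ω S m _) _ (Function.uncurry F)) :
    ∫⁻ ω, F ω (Z ω) ∂P = ∫⁻ ω, ∫⁻ z, F ω z ∂(condLaw m P Z ω) ∂P :=
  @lintegral_condDistrib Ω Ω S mΩ m _ _ _ P _ id (measurable_id'' hm) Z hZ (Function.uncurry F) hF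

theorem ae_ae_condLaw (hm : m ≤ mΩ) (hZ : Measurable Z) {s : Set S} (hs : MeasurableSet s)
    (h : ∀ᵐ ω ∂P, Z ω ∈ s) : ∀ᵐ ω ∂P, ∀ᵐ z ∂(condLaw m P Z ω), z ∈ s := by
  have hi : Measurable (sᶜ.indicator (1 : S → ℝ≥0∞)) := measurable_one.indicator hs.compl
  have h1 := lintegral_condLaw (P := P) hm hZ (F := fun _ z => sᶜ.indicator (1 : S → ℝ≥0∞) z)
    (@Measurable.comp _ _ _ (@Prod.instMeasurableSpace Ω S m _) _ _ _ _ hi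
      (@measurable_snd Ω S m _))
  have h2 : ∫⁻ ω, sᶜ.indicator (1 : S → ℝ≥0∞) (Z ω) ∂P = 0 := by
    refine (lintegral_eq_zero_iff (hi.comp hZ)).2 ?_
    filter_upwards [h] with ω hω
    simp [hω]
  rw [h2] at h1
  have hmeas : Measurable[m] fun ω => ∫⁻ z, sᶜ.indicator (1 : S → ℝ≥0∞) z ∂(condLaw m P Z ω) := by
    simp only [lintegral_indicator_one hs.compl]
    unfold condLaw
    exact ProbabilityTheory.Kernel.measurable_coe _ hs.compl
  have h3 := (lintegral_eq_zero_iff (hmeas.mono hm le_rfl)).1 h1.symm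
  filter_upwards [h3] with ω hω
  rw [lintegral_indicator_one hs.compl] at hω
  exact hω

theorem condExp_ae_eq_integral_condLaw (hm : m ≤ mΩ) (hZ : Measurable Z) {f : S → ℝ}
    (hf : Measurable f) (hf_int : Integrable (fun ω => f (Z ω)) P) :
    P[fun ω => f (Z ω) | m] =ᵐ[P] fun ω => ∫ z, f z ∂(condLaw m P Z ω) := by
  have h := @ProbabilityTheory.condExp_ae_eq_integral_condDistrib Ω Ω S ℝ _ _ _ _ mΩ P _ id Z m
    _ _ (measurable_id'' hm) hZ.aemeasurable f hf.stronglyMeasurable hf_int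
  rwa [MeasurableSpace.comap_id] at h

theorem measurable_integral_condLaw {F : Ω → S → ℝ}
    (hF : @Measurable _ _ (@Prod.instMeasurableSpace Ω S m _) _ (Function.uncurry F)) :
    Measurable[m] fun ω => ∫ z, F ω z ∂(condLaw m P Z ω) :=
  @measurable_integral_condDistrib Ω Ω S mΩ m _ _ _ P _ id Z (Function.uncurry F) hF

end CondLaw

/-! ### The exponential supermartingale -/

/-- The conditional mean of `Z + Z²` for `Z = q s - b`, when `s` has mean `e` and second
moment `V`. -/
def compensator (q b e V : ℝ) : ℝ :=
  q * e - b + (q ^ 2 * V - 2 * b * q * e + b ^ 2)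

/-- Integrate `exp ψ(Z) ≤ 1 + Z + Z²`, then use `1 + x ≤ exp x`. -/
theorem lintegral_exp_psi_le {S : Type*} [MeasurableSpace S] (κ : Measure S)
    [IsProbabilityMeasure κ] {s : S → ℝ} (hs : Measurable s) {K : ℝ} (hK : ∀ᵐ z ∂κ, |s z| ≤ K)
    (q b : ℝ) :
    ∫⁻ z, ENNReal.ofReal (Real.exp (psi (q * s z - b))) ∂κ
      ≤ ENNReal.ofReal (Real.exp (compensator q b (∫ z, s z ∂κ) (∫ z, s z ^ 2 ∂κ))) := by
  have h1 : Integrable s κ := Integrable.of_bound hs.aestronglyMeasurable K hK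
  have h2 : Integrable (fun z => s z ^ 2) κ := by
    refine Integrable.of_bound (hs.pow_const 2).aestronglyMeasurable (K ^ 2) ?_
    filter_upwards [hK] with z hz
    rw [norm_pow, Real.norm_eq_abs]
    gcongr
  have h3 : (fun z => 1 + (q * s z - b) + (q * s z - b) ^ 2)
      = fun z => (1 - b + b ^ 2) + ((q - 2 * b * q) * s z + q ^ 2 * s z ^ 2) := by
    funext z; ring
  have h4 : Integrable (fun z => (q - 2 * b * q) * s z + q ^ 2 * s z ^ 2) κ :=
    (h1.const_mul _).add (h2.const_mul _)
  have hint : Integrable (fun z => 1 + (q * s z - b) + (q * s z - b) ^ 2) κ := by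
    rw [h3]
    exact (integrable_const _).add h4
  calc _ ≤ ∫⁻ z, ENNReal.ofReal (1 + (q * s z - b) + (q * s z - b) ^ 2) ∂κ :=
        lintegral_mono fun z => ENNReal.ofReal_le_ofReal (exp_psi_le _)
    _ = ENNReal.ofReal (∫ z, (1 + (q * s z - b) + (q * s z - b) ^ 2) ∂κ) :=
        (ofReal_integral_eq_lintegral_ofReal hint (ae_of_all _ fun z =>
          (Real.exp_pos _).le.trans (exp_psi_le _))).symm
    _ ≤ _ := by
        refine ENNReal.ofReal_le_ofReal (le_trans (le_of_eq ?_) (Real.add_one_le_exp _))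
        rw [h3, integral_add (integrable_const _) h4,
          integral_add (h1.const_mul _) (h2.const_mul _), integral_const_mul, integral_const_mul,
          integral_const, compensator]
        simp
        ring

/-- The supermartingale property is tested against nonnegative past-measurable `Y`, which avoids
integrability questions; rounds are peeled off from the last one. -/
theorem lintegral_prod_le_one {Ω : Type*} {mΩ : MeasurableSpace Ω} (P : Measure Ω)
    [IsProbabilityMeasure P] (ℱ : Filtration ℕ mΩ) {T : ℕ} (D : Fin T → Ω → ℝ≥0∞)
    (hD : ∀ t : Fin T, Measurable[ℱ ((t : ℕ) + 1)] (D t))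
    (h : ∀ (t : Fin T) (Y : Ω → ℝ≥0∞), Measurable[ℱ (t : ℕ)] Y →
      ∫⁻ ω, Y ω * D t ω ∂P ≤ ∫⁻ ω, Y ω ∂P) :
    ∫⁻ ω, ∏ t, D t ω ∂P ≤ 1 := by
  induction T with
  | zero => simp
  | succ n ih =>
    simp only [Fin.prod_univ_castSucc]
    refine (h (Fin.last n) _ ?_).trans (ih _ (fun t => hD t.castSucc) fun t => h t.castSucc)
    refine Finset.measurable_fun_prod _ fun t _ => (hD t.castSucc).mono (ℱ.mono ?_) le_rfl
    simp only [Fin.val_castSucc, Fin.val_last]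
    omega

/-- Markov's inequality at level `card / δ` gives each index failure probability `δ / card`; then a
union bound. -/
theorem measure_exists_lt_le {Ω ι : Type*} {mΩ : MeasurableSpace Ω} (P : Measure Ω)
    (I : Finset ι) (W : ι → Ω → ℝ) (hW : ∀ i ∈ I, Measurable (W i))
    (h : ∀ i ∈ I, ∫⁻ ω, ENNReal.ofReal (Real.exp (W i ω)) ∂P ≤ 1) {δ : ℝ} (hδ : 0 < δ) :
    P {ω | ∃ i ∈ I, Real.log (I.card / δ) < W i ω} ≤ ENNReal.ofReal δ := by
  have hset : {ω | ∃ i ∈ I, Real.log (I.card / δ) < W i ω}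
      ⊆ ⋃ i ∈ I, {ω | ENNReal.ofReal (I.card / δ) ≤ ENNReal.ofReal (Real.exp (W i ω))} := by
    rintro ω ⟨i, hi, hω⟩
    simp only [Set.mem_iUnion, Set.mem_ofPred_eq]
    have hc : (0 : ℝ) < I.card := by exact_mod_cast Finset.card_pos.2 ⟨i, hi⟩
    exact ⟨i, hi, ENNReal.ofReal_le_ofReal ((Real.log_le_iff_le_exp (by positivity)).1 hω.le)⟩
  refine (measure_mono hset).trans ((measure_biUnion_finset_le _ _).trans ?_)
  rcases I.eq_empty_or_nonempty with rfl | hI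
  · simp
  have hc : (0 : ℝ) < I.card := by exact_mod_cast Finset.card_pos.2 hI
  have h1 : ∀ i ∈ I, P {ω | ENNReal.ofReal (I.card / δ) ≤ ENNReal.ofReal (Real.exp (W i ω))}
      ≤ ENNReal.ofReal (δ / I.card) := by
    intro i hi
    have hne : ENNReal.ofReal (I.card / δ) ≠ 0 := by
      rw [Ne, ENNReal.ofReal_eq_zero, not_le]; positivity
    refine (meas_ge_le_lintegral_div ((hW i hi).exp.ennreal_ofReal).aemeasurable hne
      ENNReal.ofReal_ne_top).trans ?_
    rw [ENNReal.div_le_iff hne ENNReal.ofReal_ne_top, ← ENNReal.ofReal_mul (by positivity)]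
    refine (h i hi).trans (le_of_eq ?_)
    rw [← ENNReal.ofReal_one]
    congr 1
    field_simp
  refine (Finset.sum_le_sum h1).trans (le_of_eq ?_)
  rw [Finset.sum_const, nsmul_eq_mul, ← ENNReal.ofReal_natCast, ← ENNReal.ofReal_mul hc.le]
  congr 1
  field_simp

@[fun_prop]
theorem measurable_psi : Measurable psi := psi_continuous.measurable

theorem measurable_compensator {α : Type*} [MeasurableSpace α] {q e V : α → ℝ} (b : ℝ)
    (hq : Measurable q) (he : Measurable e) (hV : Measurable V) :
    Measurable fun x => compensator (q x) b (e x) (V x) := by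
  unfold compensator
  fun_prop

/-- The density increment of the exponential supermartingale. -/
noncomputable def expIncrement (q b s e V : ℝ) : ℝ≥0∞ :=
  ENNReal.ofReal (Real.exp (psi (q * s - b) - compensator q b e V))

theorem measurable_mul_expIncrement {β S : Type*} {mβ : MeasurableSpace β} [MeasurableSpace S]
    {Y : β → ℝ≥0∞} (hY : Measurable Y) {q e V : β → ℝ} (b : ℝ) (hq : Measurable q)
    (he : Measurable e) (hV : Measurable V) {s : β → S → ℝ} (hs : Measurable (Function.uncurry s)) :
    Measurable (Function.uncurry fun ω z => Y ω * expIncrement (q ω) b (s ω z) (e ω) (V ω)) := by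
  have hC : Measurable fun p : β × S => compensator (q p.1) b (e p.1) (V p.1) :=
    (measurable_compensator b hq he hV).comp measurable_fst
  have hs' : Measurable fun p : β × S => s p.1 p.2 := hs
  change Measurable fun p : β × S => Y p.1 *
    ENNReal.ofReal (Real.exp (psi (q p.1 * s p.1 p.2 - b) - compensator (q p.1) b (e p.1) (V p.1)))
  fun_prop

theorem lintegral_mul_expIncrement_le {Ω S : Type*} {m mΩ : MeasurableSpace Ω}
    [MeasurableSpace S] [StandardBorelSpace S] [Nonempty S] {P : Measure Ω}
    [IsProbabilityMeasure P] {Z : Ω → S} (hm : m ≤ mΩ) (hZ : Measurable Z)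
    {Y : Ω → ℝ≥0∞} (hY : Measurable[m] Y) {q e V : Ω → ℝ} (b : ℝ) (hq : Measurable[m] q)
    (he : Measurable[m] e) (hV : Measurable[m] V) {s : Ω → S → ℝ}
    (hs : @Measurable _ _ (@Prod.instMeasurableSpace Ω S m _) _ (Function.uncurry s))
    (K : Ω → ℝ) (hK : ∀ᵐ ω ∂P, ∀ᵐ z ∂(condLaw m P Z ω), |s ω z| ≤ K ω)
    (hes : ∀ᵐ ω ∂P, ∫ z, s ω z ∂(condLaw m P Z ω) = e ω)
    (hVs : ∀ᵐ ω ∂P, ∫ z, s ω z ^ 2 ∂(condLaw m P Z ω) = V ω) :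
    ∫⁻ ω, Y ω * expIncrement (q ω) b (s ω (Z ω)) (e ω) (V ω) ∂P ≤ ∫⁻ ω, Y ω ∂P := by
  rw [lintegral_condLaw hm hZ
    (F := fun ω z => Y ω * expIncrement (q ω) b (s ω z) (e ω) (V ω))
    (@measurable_mul_expIncrement Ω S m _ Y hY q e V b hq he hV s hs)]
  refine lintegral_mono_ae ?_
  filter_upwards [hK, hes, hVs] with ω hKω heω hVω
  have hsω : Measurable (s ω) := by
    have := @Measurable.of_uncurry_left Ω S ℝ m _ _ s hs ω
    exact this
  have h1 := lintegral_exp_psi_le (condLaw m P Z ω) hsω hKω (q ω) b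
  rw [heω, hVω] at h1
  have h2 : ∀ z, expIncrement (q ω) b (s ω z) (e ω) (V ω)
      = ENNReal.ofReal (Real.exp (-compensator (q ω) b (e ω) (V ω)))
        * ENNReal.ofReal (Real.exp (psi (q ω * s ω z - b))) := fun z => by
    rw [expIncrement, ← ENNReal.ofReal_mul (Real.exp_pos _).le, ← Real.exp_add]
    ring_nf
  have h3 : Measurable fun z => ENNReal.ofReal (Real.exp (psi (q ω * s ω z - b))) := by fun_prop
  simp only [h2]
  rw [lintegral_const_mul _ (h3.const_mul _), lintegral_const_mul _ h3]
  calc _ ≤ Y ω * (ENNReal.ofReal (Real.exp (-compensator (q ω) b (e ω) (V ω)))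
        * ENNReal.ofReal (Real.exp (compensator (q ω) b (e ω) (V ω)))) := by gcongr
    _ = Y ω := by
        rw [← ENNReal.ofReal_mul (Real.exp_pos _).le, ← Real.exp_add]
        simp

/-! ### Integrals against the vector of signed measures -/

theorem vecIntegral_apply_sub_le {d d' : ℕ} (μ : Fin d → SignedMeasure (UnitBall d'))
    {f g : EuclideanSpace ℝ (Fin d') → ℝ} (hf : Measurable f) (hg : Measurable g) {H ε : ℝ}
    (hfH : ∀ x, |f x| ≤ H) (hgH : ∀ x, |g x| ≤ H) (hfg : ∀ x, ‖x‖ ≤ 1 → |f x - g x| ≤ ε)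
    (i : Fin d) :
    |vecIntegral μ f i - vecIntegral μ g i| ≤ ε * totalMass μ i := by
  have hfin : IsFiniteMeasure (μ i).variation := by
    rw [← SignedMeasure.totalVariation_eq_variation]; infer_instance
  have hint : ∀ k : EuclideanSpace ℝ (Fin d') → ℝ, Measurable k → (∀ x, |k x| ≤ H) →
      (μ i).Integrable fun x : UnitBall d' => k x := fun k hk hkH =>
    Integrable.of_bound (hk.comp measurable_subtype_coe).aestronglyMeasurable H
      (ae_of_all _ fun x => hkH x)
  have h1 := VectorMeasure.integral_fun_sub (B := (ContinuousLinearMap.lsmul ℝ ℝ).flip)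
    (hint f hf hfH) (hint g hg hgH)
  have h2 := VectorMeasure.norm_integral_le_integral_norm (μ := μ i)
    (f := fun x : UnitBall d' => f x - g x) (B := (ContinuousLinearMap.lsmul ℝ ℝ).flip)
  have hB : ‖(ContinuousLinearMap.lsmul ℝ ℝ : ℝ →L[ℝ] ℝ →L[ℝ] ℝ).flip‖ ≤ 1 := by
    rw [ContinuousLinearMap.opNorm_flip]
    exact ContinuousLinearMap.opNorm_lsmul_le
  have h3 : ∫ x : UnitBall d', ‖f x - g x‖ ∂(μ i).variation ≤ ε * totalMass μ i := by
    calc _ ≤ ∫ x : UnitBall d', ε ∂(μ i).variation := by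
          refine integral_mono_of_nonneg (ae_of_all _ fun x => norm_nonneg _)
            (integrable_const _) (ae_of_all _ fun x => hfg x ?_)
          exact mem_closedBall_zero_iff.1 x.2
      _ = _ := by
          rw [integral_const, smul_eq_mul, mul_comm,
            ← SignedMeasure.totalVariation_eq_variation]
          rfl
  have h4 : 0 ≤ ∫ x : UnitBall d', ‖f x - g x‖ ∂(μ i).variation :=
    integral_nonneg fun x => norm_nonneg _
  calc _ = ‖(μ i).integral (fun x : UnitBall d' => f x - g x)
        (ContinuousLinearMap.lsmul ℝ ℝ).flip‖ := by rw [h1]; rfl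
    _ ≤ 1 * ∫ x : UnitBall d', ‖f x - g x‖ ∂(μ i).variation := h2.trans (by gcongr)
    _ ≤ _ := by rw [one_mul]; exact h3

/-- Stability of `θ = u⋆ + ∫ f dμ` when `f⋆` is replaced by a net function. Closeness on the unit
ball is enough, since `μ` lives there. -/
theorem norm_vecIntegral_sub_le {d d' : ℕ} (μ : Fin d → SignedMeasure (UnitBall d'))
    {f g : EuclideanSpace ℝ (Fin d') → ℝ} (hf : Measurable f) (hg : Measurable g) {H ε : ℝ}
    (hε : 0 ≤ ε) (hfH : ∀ x, |f x| ≤ H) (hgH : ∀ x, |g x| ≤ H)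
    (hfg : ∀ x, ‖x‖ ≤ 1 → |f x - g x| ≤ ε) :
    ‖vecIntegral μ f - vecIntegral μ g‖ ≤ ε * ‖totalMass μ‖ := by
  rw [← abs_of_nonneg hε, ← Real.norm_eq_abs, ← norm_smul]
  rw [EuclideanSpace.norm_eq, EuclideanSpace.norm_eq]
  refine Real.sqrt_le_sqrt (Finset.sum_le_sum fun i _ => ?_)
  have h := vecIntegral_apply_sub_le μ hf hg hfH hgH hfg i
  rw [Real.norm_eq_abs, Real.norm_eq_abs]
  refine pow_le_pow_left₀ (abs_nonneg _) ?_ 2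
  exact h.trans (le_abs_self _)

theorem vecIntegral_zero {d d' : ℕ} (μ : Fin d → SignedMeasure (UnitBall d')) :
    vecIntegral μ (fun _ => 0) = 0 := by
  ext i
  simp [vecIntegral]

theorem norm_vecIntegral_le {d d' : ℕ} (μ : Fin d → SignedMeasure (UnitBall d'))
    {f : EuclideanSpace ℝ (Fin d') → ℝ} (hf : Measurable f) {H : ℝ} (hH : 0 ≤ H)
    (hfH : ∀ x, |f x| ≤ H) : ‖vecIntegral μ f‖ ≤ H * ‖totalMass μ‖ := by
  have h := norm_vecIntegral_sub_le μ hf measurable_const hH hfH (g := fun _ => 0)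
    (fun _ => by simpa using hH) (fun x _ => by simpa using hfH x)
  rwa [vecIntegral_zero, sub_zero] at h

/-! ### Nets -/

/-- The covering number concerns restrictions to the ball; each centre is lifted back to a member of
`F`, which therefore keeps the measurability and boundedness of the class. -/
theorem exists_finset_cover {n : ℕ} {F : Set (EuclideanSpace ℝ (Fin n) → ℝ)} {ε : ℝ≥0} {N : ℕ}
    (h : supCoveringNumber F ε = N) :
    ∃ C : Finset (EuclideanSpace ℝ (Fin n) → ℝ), (∀ g ∈ C, g ∈ F) ∧ C.card ≤ N ∧
      ∀ f ∈ F, ∃ g ∈ C, ∀ x, ‖x‖ ≤ 1 → |f x - g x| ≤ ε := by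
  classical
  obtain ⟨C, hCF, hfin, hcov, hcard⟩ := Metric.exists_set_encard_eq_coveringNumber
    (show Metric.coveringNumber ε ((fun f : EuclideanSpace ℝ (Fin n) → ℝ =>
      UniformFun.ofFun ((UnitBall n).domRestrict f)) '' F) ≠ ⊤ by
        change supCoveringNumber F ε ≠ ⊤
        rw [h]; exact ENat.natCast_ne_top N)
  change C.encard = supCoveringNumber F ε at hcard
  have hCF' : ∀ c ∈ C, ∃ f ∈ F, UniformFun.ofFun ((UnitBall n).domRestrict f) = c :=
    fun c hc => hCF hc
  choose! pre hpre hpre' using hCF'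
  refine ⟨hfin.toFinset.image pre, ?_, ?_, ?_⟩
  · intro g hg
    obtain ⟨c, hc, rfl⟩ := Finset.mem_image.1 hg
    exact hpre c (hfin.mem_toFinset.1 hc)
  · refine Finset.card_image_le.trans ?_
    rw [h, hfin.encard_eq_coe_toFinset_card] at hcard
    exact_mod_cast hcard.le
  · intro f hf
    obtain ⟨c, hc, hd⟩ := hcov (Set.mem_image_of_mem _ hf)
    refine ⟨pre c, Finset.mem_image_of_mem _ (hfin.mem_toFinset.2 hc), fun x hx => ?_⟩
    have h1 : edist (UniformFun.ofFun ((UnitBall n).domRestrict f)) c ≤ ε := hd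
    rw [← hpre' c hc] at h1
    have h2 := UniformFun.edist_le.1 h1 ⟨x, by simpa using hx⟩
    rw [edist_dist, ← ENNReal.ofReal_coe_nnreal] at h2
    exact (ENNReal.ofReal_le_ofReal_iff ε.coe_nonneg).1 h2

/-- The integers of absolute value at most `M`, scaled by `ρ`, form a net of step `ρ`. -/
theorem exists_int_grid {ρ : ℝ} (hρ : 0 < ρ) {M : ℕ} {x : ℝ} (hx : |x| ≤ M * ρ) :
    ∃ k ∈ Finset.Icc (-(M : ℤ)) M, |x - k * ρ| ≤ ρ := by
  have h1 := abs_le.1 hx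
  refine ⟨⌊x / ρ⌋, ?_, ?_⟩
  · rw [Finset.mem_Icc]
    constructor
    · rw [Int.le_floor, le_div_iff₀ hρ]
      push_cast
      linarith
    · rw [← Int.lt_add_one_iff, Int.floor_lt, div_lt_iff₀ hρ]
      push_cast
      nlinarith
  · have h2 := Int.floor_le (x / ρ)
    have h3 := Int.lt_floor_add_one (x / ρ)
    rw [le_div_iff₀ hρ] at h2
    rw [div_lt_iff₀ hρ] at h3
    rw [abs_le]
    constructor <;> nlinarith

theorem norm_le_sum_abs {d : ℕ} (x : EuclideanSpace ℝ (Fin d)) : ‖x‖ ≤ ∑ i, |x i| := by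
  rw [EuclideanSpace.norm_eq, Real.sqrt_le_left (Finset.sum_nonneg fun i _ => abs_nonneg _)]
  simp only [Real.norm_eq_abs]
  exact Finset.sum_sq_le_sq_sum_of_nonneg fun i _ => abs_nonneg _

/-- A net of the pairs `(a, b)` of a vector and a scalar. -/
theorem exists_net (d : ℕ) {ρ : ℝ} (hρ : 0 < ρ) (M : ℕ) :
    ∃ N : Finset (EuclideanSpace ℝ (Fin d) × ℝ), N.card ≤ (2 * M + 1) ^ (d + 1) ∧
      ∀ (a : EuclideanSpace ℝ (Fin d)) (b : ℝ), ‖a‖ ≤ M * ρ → |b| ≤ M * ρ →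
        ∃ p ∈ N, ‖a - p.1‖ ≤ d * ρ ∧ |b - p.2| ≤ ρ := by
  classical
  let I : Finset ℤ := Finset.Icc (-(M : ℤ)) M
  have hI : I.card = 2 * M + 1 := by
    simp only [I, Int.card_Icc]
    omega
  refine ⟨((Fintype.piFinset fun _ : Fin d => I) ×ˢ I).image
    fun k => (WithLp.toLp 2 fun i => (k.1 i : ℝ) * ρ, (k.2 : ℝ) * ρ), ?_, ?_⟩
  · refine Finset.card_image_le.trans (le_of_eq ?_)
    rw [Finset.card_product, Fintype.card_piFinset, hI, Finset.prod_const, Finset.card_univ,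
      Fintype.card_fin, pow_succ]
  · intro a b ha hb
    choose k hk hk' using fun i =>
      exists_int_grid hρ (((EuclideanSpace.norm_eq a ▸ PiLp.norm_apply_le a i :
        ‖a i‖ ≤ _).trans (EuclideanSpace.norm_eq a ▸ ha) : |a i| ≤ M * ρ))
    obtain ⟨l, hl, hl'⟩ := exists_int_grid hρ hb
    refine ⟨_, Finset.mem_image_of_mem _ (Finset.mem_product.2
      ⟨Fintype.mem_piFinset.2 hk, hl⟩ : (k, l) ∈ _), ?_, hl'⟩
    refine (norm_le_sum_abs _).trans ?_
    calc _ ≤ ∑ i : Fin d, ρ := Finset.sum_le_sum fun i _ => by simpa using hk' i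
      _ = d * ρ := by simp

/-! ### Perturbation of the parameters -/

theorem abs_mul_sub_mul_le {x x' y y' X Y ξ υ : ℝ} (hX : |x'| ≤ X) (hY : |y| ≤ Y)
    (hξ : |x - x'| ≤ ξ) (hυ : |y - y'| ≤ υ) : |x * y - x' * y'| ≤ ξ * Y + X * υ := by
  have h : x * y - x' * y' = (x - x') * y + x' * (y - y') := by ring
  rw [h]
  refine (abs_add_le _ _).trans ?_
  rw [abs_mul, abs_mul]
  have := abs_nonneg x'
  have := abs_nonneg y
  have := abs_nonneg (x - x')
  have := abs_nonneg (y - y')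
  gcongr
  · linarith
  · linarith

/-- Here `g = σ⁻²`, `v = σ²`, and primes mark the net point. The second-moment bound turns `(g h')²
V'` into `g h'² / 2` up to an error, because `g v = 1`; every other term is moved by its Lipschitz
constant. -/
theorem psi_le_of_perturbation {g h h' e e' b b' s s' V' v B ξ : ℝ} (hB : 1 ≤ B) (hg : 0 ≤ g)
    (hgB : g ≤ B) (hv : g * v = 1)
    (hh : |h| ≤ B) (hh' : |h'| ≤ B) (he : |e| ≤ B)
    (hb : |b| ≤ B) (hb' : |b'| ≤ B) (hs : |s| ≤ B)
    (hdh : |h - h'| ≤ ξ) (hde : |e - e'| ≤ ξ) (hdb : |b - b'| ≤ ξ) (hds : |s - s'| ≤ ξ)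
    (hV : V' ≤ 1 / 2 * v + ξ) :
    psi (g * h * s - b) ≤ (psi (g * h' * s' - b') - compensator (g * h') b' e' V')
      + (g * h * e - b + (1 / 2 * (g * h ^ 2) - 2 * b * (g * h * e) + b ^ 2)) + 20 * B ^ 4 * ξ := by
  have hξ : 0 ≤ ξ := (abs_nonneg _).trans hdh
  have hscale : ∀ {x y : ℝ}, |x - y| ≤ ξ * B + B * ξ → |g * x - g * y| ≤ 2 * B ^ 2 * ξ := by
    intro x y hxy
    rw [← mul_sub, abs_mul, abs_of_nonneg hg]
    calc _ ≤ B * (ξ * B + B * ξ) := by gcongr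
      _ = _ := by ring
  have h1 : |g * (h * s) - g * (h' * s')| ≤ 2 * B ^ 2 * ξ :=
    hscale (abs_mul_sub_mul_le hh' hs hdh hds)
  have h2 : |g * (h * e) - g * (h' * e')| ≤ 2 * B ^ 2 * ξ :=
    hscale (abs_mul_sub_mul_le hh' he hdh hde)
  have h3 : |g * (h * h) - g * (h' * h')| ≤ 2 * B ^ 2 * ξ :=
    hscale (abs_mul_sub_mul_le hh' hh hdh hdh)
  have h4 : |g * (h * e)| ≤ B ^ 3 := by
    rw [abs_mul, abs_mul, abs_of_nonneg hg]
    calc _ ≤ B * (B * B) := by gcongr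
      _ = _ := by ring
  have h5 : |b * (g * (h * e)) - b' * (g * (h' * e'))| ≤ ξ * B ^ 3 + B * (2 * B ^ 2 * ξ) :=
    abs_mul_sub_mul_le hb' h4 hdb h2
  have h6 : |b * b - b' * b'| ≤ ξ * B + B * ξ := abs_mul_sub_mul_le hb' hb hdb hdb
  have h7 : psi (g * h * s - b) - psi (g * h' * s' - b') ≤ 2 * (2 * B ^ 2 * ξ + ξ) := by
    refine (psi_sub_le _ _).trans ?_
    have : g * h * s - b - (g * h' * s' - b')
        = (g * (h * s) - g * (h' * s')) - (b - b') := by ring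
    rw [this]
    gcongr
    exact (abs_sub _ _).trans (by gcongr)
  have h8 : (g * h') ^ 2 * V' ≤ 1 / 2 * (g * (h' * h')) + B ^ 4 * ξ := by
    have h9 : (g * h') ^ 2 ≤ B ^ 4 := by
      rw [← sq_abs, abs_mul, abs_of_nonneg hg]
      calc _ ≤ (B * B) ^ 2 := by gcongr
        _ = _ := by ring
    calc (g * h') ^ 2 * V' ≤ (g * h') ^ 2 * (1 / 2 * v + ξ) := by gcongr
      _ = 1 / 2 * (g * v) * (g * (h' * h')) + (g * h') ^ 2 * ξ := by ring
      _ ≤ 1 / 2 * 1 * (g * (h' * h')) + B ^ 4 * ξ := by rw [hv]; gcongr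
      _ = _ := by ring
  have hB2 : B ^ 2 ≤ B ^ 4 := pow_le_pow_right₀ hB (by norm_num)
  have hB3 : B ^ 3 ≤ B ^ 4 := pow_le_pow_right₀ hB (by norm_num)
  have hB1 : B ≤ B ^ 4 := le_self_pow₀ hB (by norm_num)
  have hB0 : 1 ≤ B ^ 4 := one_le_pow₀ hB
  have k1 := mul_le_mul_of_nonneg_right hB1 hξ
  have k2 := mul_le_mul_of_nonneg_right hB2 hξ
  have k3 := mul_le_mul_of_nonneg_right hB3 hξ
  have k0 := mul_le_mul_of_nonneg_right hB0 hξ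
  rw [abs_le] at h2 h3 h5 h6 hdb
  unfold compensator
  -- The collected coefficients are `4B² + 2` from `ψ` and `2B² + 1 + B⁴ + B² + 6B³ + 2B` from the
  -- compensator, at most `19 B⁴` together.
  linarith [h2.1, h2.2, h3.1, h3.2, h5.1, h5.2, h6.1, h6.2, hdb.1, hdb.2]

/-- The integral of a square changes little under a uniform perturbation. -/
theorem integral_sq_le_of_perturbation {S : Type*} [MeasurableSpace S] (κ : Measure S)
    [IsProbabilityMeasure κ] {s s' : S → ℝ} (hs : Measurable s) (hs' : Measurable s') {K ε : ℝ}
    (hK : ∀ᵐ z ∂κ, |s z| ≤ K) (hK' : ∀ᵐ z ∂κ, |s' z| ≤ K) (hε : ∀ᵐ z ∂κ, |s z - s' z| ≤ ε) :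
    ∫ z, s' z ^ 2 ∂κ ≤ ∫ z, s z ^ 2 ∂κ + 2 * K * ε := by
  have hint : ∀ k : S → ℝ, Measurable k → (∀ᵐ z ∂κ, |k z| ≤ K) →
      Integrable (fun z => k z ^ 2) κ := by
    intro k hk hkK
    refine Integrable.of_bound (hk.pow_const 2).aestronglyMeasurable (K ^ 2) ?_
    filter_upwards [hkK] with z hz
    rw [norm_pow, Real.norm_eq_abs]
    gcongr
  have h1 : ∫ z, s' z ^ 2 ∂κ ≤ ∫ z, (s z ^ 2 + 2 * K * ε) ∂κ := by
    refine integral_mono_ae (hint s' hs' hK') ((hint s hs hK).add (integrable_const _)) ?_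
    filter_upwards [hK, hK', hε] with z h1 h2 h3
    have h4 : |s' z ^ 2 - s z ^ 2| ≤ 2 * K * ε := by
      have h5 : s' z ^ 2 - s z ^ 2 = (s' z + s z) * (s' z - s z) := by ring
      rw [h5, abs_mul, abs_sub_comm (s' z)]
      have h6 : |s' z + s z| ≤ 2 * K := (abs_add_le _ _).trans (by linarith)
      exact mul_le_mul h6 h3 (abs_nonneg _) ((abs_nonneg _).trans h6)
    have := (abs_le.1 h4).2
    change s' z ^ 2 ≤ s z ^ 2 + 2 * K * ε
    linarith
  refine h1.trans (le_of_eq ?_)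
  rw [integral_add (hint s hs hK) (integrable_const _), integral_const]
  simp

/-! ### The regression process -/

/-- The response `⟨x, u⟩ + f (φ') + η` as a function of `z = (φ', η)`. -/
noncomputable def response {d d' : ℕ} (u : EuclideanSpace ℝ (Fin d))
    (f : EuclideanSpace ℝ (Fin d') → ℝ) (x : EuclideanSpace ℝ (Fin d))
    (z : EuclideanSpace ℝ (Fin d') × ℝ) : ℝ :=
  inner ℝ x u + f z.1 + z.2

theorem measurable_response {β : Type*} {mβ : MeasurableSpace β} {d d' : ℕ}
    (u : EuclideanSpace ℝ (Fin d)) {f : EuclideanSpace ℝ (Fin d') → ℝ} (hf : Measurable f)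
    {x : β → EuclideanSpace ℝ (Fin d)} (hx : Measurable x) :
    Measurable (Function.uncurry fun ω z => response u f (x ω) z) := by
  change Measurable fun p : β × (EuclideanSpace ℝ (Fin d') × ℝ) =>
    inner ℝ (x p.1) u + f p.2.1 + p.2.2
  fun_prop

theorem measurable_response_right {d d' : ℕ} (u x : EuclideanSpace ℝ (Fin d))
    {f : EuclideanSpace ℝ (Fin d') → ℝ} (hf : Measurable f) : Measurable (response u f x) := by
  unfold response
  fun_prop

theorem measurable_response_sq {β : Type*} {mβ : MeasurableSpace β} {d d' : ℕ}
    (u : EuclideanSpace ℝ (Fin d)) {f : EuclideanSpace ℝ (Fin d') → ℝ} (hf : Measurable f)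
    {x : β → EuclideanSpace ℝ (Fin d)} (hx : Measurable x) :
    Measurable (Function.uncurry fun ω z => response u f (x ω) z ^ 2) :=
  (measurable_response u hf hx).pow_const 2

theorem measurable_weight {β : Type*} {mβ : MeasurableSpace β} {d : ℕ}
    (a : EuclideanSpace ℝ (Fin d)) {x : β → EuclideanSpace ℝ (Fin d)} {σ : β → ℝ}
    (hx : Measurable x) (hσ : Measurable σ) :
    Measurable fun ω => ((σ ω) ^ 2)⁻¹ * (inner ℝ a (x ω) : ℝ) := by
  fun_prop

theorem measurable_inner_right {β : Type*} {mβ : MeasurableSpace β} {d : ℕ}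
    (a : EuclideanSpace ℝ (Fin d)) {x : β → EuclideanSpace ℝ (Fin d)} (hx : Measurable x) :
    Measurable fun ω => (inner ℝ (x ω) a : ℝ) := by
  fun_prop

theorem measurable_psi_sub_compensator {β : Type*} {mβ : MeasurableSpace β} {d d' : ℕ}
    (u : EuclideanSpace ℝ (Fin d)) {f : EuclideanSpace ℝ (Fin d') → ℝ} (hf : Measurable f)
    {x : β → EuclideanSpace ℝ (Fin d)} (hx : Measurable x)
    {z : β → EuclideanSpace ℝ (Fin d') × ℝ} (hz : Measurable z) {q e V : β → ℝ} (b : ℝ)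
    (hq : Measurable q) (he : Measurable e) (hV : Measurable V) :
    Measurable fun ω =>
      psi (q ω * response u f (x ω) (z ω) - b) - compensator (q ω) b (e ω) (V ω) := by
  have hr : Measurable fun ω => response u f (x ω) (z ω) :=
    (measurable_response u hf hx).comp (measurable_id.prodMk hz)
  exact (measurable_psi.comp ((hq.mul hr).sub measurable_const)).sub
    (measurable_compensator b hq he hV)

theorem abs_response_le {d d' : ℕ} {u x : EuclideanSpace ℝ (Fin d)}
    {f : EuclideanSpace ℝ (Fin d') → ℝ} {z : EuclideanSpace ℝ (Fin d') × ℝ} {βu H βη : ℝ}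
    (hx : ‖x‖ ≤ 1) (hu : ‖u‖ ≤ βu) (hf : |f z.1| ≤ H) (hz : |z.2| ≤ βη) :
    |response u f x z| ≤ βu + H + βη := by
  have h1 : |inner ℝ x u| ≤ βu := by
    refine (abs_real_inner_le_norm x u).trans ?_
    calc ‖x‖ * ‖u‖ ≤ 1 * βu := by gcongr
      _ = βu := one_mul _
  exact (abs_add_three _ _ _).trans (by linarith)

section Regression

variable {Ω : Type*} {mΩ : MeasurableSpace Ω} {P : Measure Ω} [IsProbabilityMeasure P]
  {ℱ : Filtration ℕ mΩ} {d d' p T : ℕ} {H βu βμ βη σmin R : ℝ}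
  {φ : Fin T → Ω → EuclideanSpace ℝ (Fin d)} {φ' : Fin T → Ω → EuclideanSpace ℝ (Fin d')}
  {y η σ : Fin T → Ω → ℝ} {μ : Fin d → SignedMeasure (UnitBall d')}
  {ustar : EuclideanSpace ℝ (Fin d)} {F : Set (EuclideanSpace ℝ (Fin d') → ℝ)}
  {fstar : Ω → EuclideanSpace ℝ (Fin d') → ℝ}

theorem IsRegression.measurable_pair
    (h : IsRegression P ℱ p H βu βμ βη σmin R φ φ' y η σ μ ustar F fstar) (t : Fin T) :
    Measurable[ℱ ((t : ℕ) + 1)] fun ω => (φ' t ω, η t ω) :=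
  (h.measurable_feature' t).prodMk (h.measurable_noise t)

theorem IsRegression.ae_condLaw_bounded
    (h : IsRegression P ℱ p H βu βμ βη σmin R φ φ' y η σ μ ustar F fstar) :
    ∀ᵐ ω ∂P, ∀ t : Fin T, ∀ᵐ z ∂(condLaw (ℱ (t : ℕ)) P (fun ω' => (φ' t ω', η t ω')) ω),
      ‖z.1‖ ≤ 1 ∧ |z.2| ≤ βη := by
  rw [ae_all_iff]
  intro t
  have hs : MeasurableSet {z : EuclideanSpace ℝ (Fin d') × ℝ | ‖z.1‖ ≤ 1 ∧ |z.2| ≤ βη} :=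
    (measurableSet_le measurable_fst.norm measurable_const).inter
      (measurableSet_le (measurable_norm.comp measurable_snd) measurable_const)
  refine ae_ae_condLaw (ℱ.le _) ((h.measurable_pair t).mono (ℱ.le _) le_rfl) hs ?_
  filter_upwards [h.norm_feature'_le, h.noise_le] with ω h1 h2
  exact ⟨h1 t, h2 t⟩

/-- The linear conditional law and the centred noise make the response conditionally linear in `φₜ`,
for each fixed `f`. -/
theorem IsRegression.integral_response
    (h : IsRegression P ℱ p H βu βμ βη σmin R φ φ' y η σ μ ustar F fstar)
    {f : EuclideanSpace ℝ (Fin d') → ℝ} (hf : f ∈ F) (t : Fin T) :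
    ∀ᵐ ω ∂P, ∫ z, response ustar f (φ t ω) z
        ∂(condLaw (ℱ (t : ℕ)) P (fun ω' => (φ' t ω', η t ω')) ω)
      = inner ℝ (φ t ω) (ustar + vecIntegral μ f) := by
  have hfm := h.class_measurable f hf
  have hfH := h.class_bounded f hf
  have hZ : Measurable fun ω => (φ' t ω, η t ω) := (h.measurable_pair t).mono (ℱ.le _) le_rfl
  have hφ' : Measurable (φ' t) := (h.measurable_feature' t).mono (ℱ.le _) le_rfl
  have hη : Measurable (η t) := (h.measurable_noise t).mono (ℱ.le _) le_rfl
  have h1 := condExp_ae_eq_integral_condLaw (P := P) (ℱ.le (t : ℕ)) hZ (f := fun z => f z.1)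
    (hfm.comp measurable_fst)
    (Integrable.of_bound (hfm.comp hφ').aestronglyMeasurable H (ae_of_all _ fun ω => hfH _))
  have h2 := condExp_ae_eq_integral_condLaw (P := P) (ℱ.le (t : ℕ)) hZ (f := fun z => z.2)
    measurable_snd (Integrable.of_bound hη.aestronglyMeasurable βη
      (by filter_upwards [h.noise_le] with ω hω using hω t))
  have h3 := h.condExp_eq f hfm ⟨H, hfH⟩ t
  filter_upwards [h1, h2, h3, h.noise_condExp t, h.ae_condLaw_bounded] with ω k1 k2 k3 k4 k5
  have i1 : Integrable (fun z : EuclideanSpace ℝ (Fin d') × ℝ => f z.1)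
      (condLaw (ℱ (t : ℕ)) P (fun ω' => (φ' t ω', η t ω')) ω) :=
    Integrable.of_bound (hfm.comp measurable_fst).aestronglyMeasurable H
      (ae_of_all _ fun z => hfH _)
  have i2 : Integrable (fun z : EuclideanSpace ℝ (Fin d') × ℝ => z.2)
      (condLaw (ℱ (t : ℕ)) P (fun ω' => (φ' t ω', η t ω')) ω) :=
    Integrable.of_bound measurable_snd.aestronglyMeasurable βη
      (by filter_upwards [k5 t] with z hz using hz.2)
  have i3 : Integrable (fun z : EuclideanSpace ℝ (Fin d') × ℝ => inner ℝ (φ t ω) ustar + f z.1)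
      (condLaw (ℱ (t : ℕ)) P (fun ω' => (φ' t ω', η t ω')) ω) := (integrable_const _).add i1
  unfold response
  rw [integral_add i3 i2, integral_add (integrable_const _) i1, ← k1, ← k2, k3, inner_add_right]
  rw [show (fun ω => (φ' t ω, η t ω).2) = η t from rfl, k4]
  simp

variable (P ℱ φ φ' η σ μ ustar) in
/-- The logarithm of the exponential supermartingale with the parameters `a`, `b`, `f`. -/
noncomputable def logSupermartingale (f : EuclideanSpace ℝ (Fin d') → ℝ)
    (a : EuclideanSpace ℝ (Fin d)) (b : ℝ) (ω : Ω) : ℝ :=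
  ∑ t : Fin T, (psi (((σ t ω) ^ 2)⁻¹ * inner ℝ a (φ t ω)
        * response ustar f (φ t ω) (φ' t ω, η t ω) - b)
    - compensator (((σ t ω) ^ 2)⁻¹ * inner ℝ a (φ t ω)) b
        (inner ℝ (φ t ω) (ustar + vecIntegral μ f))
        (∫ z, response ustar f (φ t ω) z ^ 2
          ∂(condLaw (ℱ (t : ℕ)) P (fun ω' => (φ' t ω', η t ω')) ω)))

theorem IsRegression.measurable_summand
    (h : IsRegression P ℱ p H βu βμ βη σmin R φ φ' y η σ μ ustar F fstar)
    {f : EuclideanSpace ℝ (Fin d') → ℝ} (hf : f ∈ F) (a : EuclideanSpace ℝ (Fin d)) (t : Fin T) :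
    Measurable[ℱ (t : ℕ)] (fun ω => ((σ t ω) ^ 2)⁻¹ * inner ℝ a (φ t ω)) ∧
    Measurable[ℱ (t : ℕ)] (fun ω => (inner ℝ (φ t ω) (ustar + vecIntegral μ f) : ℝ)) ∧
    Measurable[ℱ (t : ℕ)] (fun ω => ∫ z, response ustar f (φ t ω) z ^ 2
          ∂(condLaw (ℱ (t : ℕ)) P (fun ω' => (φ' t ω', η t ω')) ω)) := by
  have h1 := h.measurable_feature t
  have h2 := h.measurable_sigma t
  refine ⟨?_, ?_, ?_⟩
  · exact measurable_weight a h1 h2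
  · exact measurable_inner_right _ h1
  · exact measurable_integral_condLaw (m := ℱ (t : ℕ))
      (@measurable_response_sq Ω (ℱ (t : ℕ)) d d' ustar f (h.class_measurable f hf) (φ t) h1)

theorem IsRegression.measurable_increment
    (h : IsRegression P ℱ p H βu βμ βη σmin R φ φ' y η σ μ ustar F fstar)
    {f : EuclideanSpace ℝ (Fin d') → ℝ} (hf : f ∈ F) (a : EuclideanSpace ℝ (Fin d)) (b : ℝ)
    (t : Fin T) :
    Measurable[ℱ ((t : ℕ) + 1)] fun ω => psi (((σ t ω) ^ 2)⁻¹ * inner ℝ a (φ t ω)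
        * response ustar f (φ t ω) (φ' t ω, η t ω) - b)
    - compensator (((σ t ω) ^ 2)⁻¹ * inner ℝ a (φ t ω)) b
        (inner ℝ (φ t ω) (ustar + vecIntegral μ f))
        (∫ z, response ustar f (φ t ω) z ^ 2
          ∂(condLaw (ℱ (t : ℕ)) P (fun ω' => (φ' t ω', η t ω')) ω)) := by
  obtain ⟨h1, h2, h3⟩ := h.measurable_summand hf a t
  have hle : ℱ (t : ℕ) ≤ ℱ ((t : ℕ) + 1) := ℱ.mono (Nat.le_succ _)
  exact measurable_psi_sub_compensator ustar (h.class_measurable f hf)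
    ((h.measurable_feature t).mono hle le_rfl) (h.measurable_pair t) b (h1.mono hle le_rfl)
    (h2.mono hle le_rfl) (h3.mono hle le_rfl)

theorem IsRegression.measurable_logSupermartingale
    (h : IsRegression P ℱ p H βu βμ βη σmin R φ φ' y η σ μ ustar F fstar)
    {f : EuclideanSpace ℝ (Fin d') → ℝ} (hf : f ∈ F) (a : EuclideanSpace ℝ (Fin d)) (b : ℝ) :
    Measurable (logSupermartingale P ℱ φ φ' η σ μ ustar f a b) :=
  Finset.measurable_fun_sum _ fun t _ => (h.measurable_increment hf a b t).mono (ℱ.le _) le_rfl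

theorem IsRegression.lintegral_exp_logSupermartingale_le_one
    (h : IsRegression P ℱ p H βu βμ βη σmin R φ φ' y η σ μ ustar F fstar)
    {f : EuclideanSpace ℝ (Fin d') → ℝ} (hf : f ∈ F) (a : EuclideanSpace ℝ (Fin d)) (b : ℝ) :
    ∫⁻ ω, ENNReal.ofReal (Real.exp (logSupermartingale P ℱ φ φ' η σ μ ustar f a b ω)) ∂P ≤ 1 := by
  simp only [logSupermartingale, Real.exp_sum,
    ENNReal.ofReal_prod_of_nonneg fun i _ => (Real.exp_pos _).le]
  refine lintegral_prod_le_one P ℱ _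
    (fun t => (h.measurable_increment hf a b t).exp.ennreal_ofReal) fun t Y hY => ?_
  obtain ⟨h1, h2, h3⟩ := h.measurable_summand hf a t
  refine lintegral_mul_expIncrement_le (ℱ.le _) ((h.measurable_pair t).mono (ℱ.le _) le_rfl) hY b
    h1 h2 h3 (s := fun ω => response ustar f (φ t ω))
    (@measurable_response Ω (ℱ (t : ℕ)) d d' ustar f (h.class_measurable f hf) (φ t)
      (h.measurable_feature t)) (fun _ => βu + H + βη) ?_ (h.integral_response hf t)
    (ae_of_all _ fun _ => rfl)
  filter_upwards [h.ae_condLaw_bounded, h.norm_feature_le] with ω k1 k2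
  filter_upwards [k1 t] with z hz
  exact abs_response_le (k2 t) h.norm_ustar_le (h.class_bounded f hf _) hz.2

end Regression

/-- The mean of `Z + Z²` for `Z = h s / v - b`, when `s` has mean `e` and second moment at most
`v / 2`, where `g = v⁻¹`. -/
noncomputable def meanBound (g h e b : ℝ) : ℝ :=
  g * h * e - b + (1 / 2 * (g * h ^ 2) - 2 * b * (g * h * e) + b ^ 2)

/-! ### From the net to all parameters. -/

theorem abs_inner_le_of_norm_le_one {d : ℕ} (a x : EuclideanSpace ℝ (Fin d)) (hx : ‖x‖ ≤ 1) :
    |inner ℝ a x| ≤ ‖a‖ :=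
  (abs_real_inner_le_norm a x).trans (mul_le_of_le_one_right (norm_nonneg _) hx)

theorem log_card_le {S R : ℝ} (hS : 20 ≤ S) (hR0 : 0 ≤ R) (hR : R ≤ S) {d p N n : ℕ} (hd : 1 ≤ d)
    (hN : Real.log N ≤ p * Real.log (1 + 2 * R / (S ^ 42)⁻¹))
    (hn : n ≤ (2 * ⌈S ^ 50⌉₊ + 1) ^ (d + 1) * N) (hn0 : 0 < n) :
    Real.log n ≤ 102 * (p + d) * Real.log S := by
  have hS0 : 0 < S := by linarith
  have hS1 : 1 ≤ S := by linarith
  have hlS : 0 ≤ Real.log S := Real.log_nonneg hS1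
  have hN0 : N ≠ 0 := by
    rintro rfl
    omega
  have h1 : Real.log n ≤ (d + 1) * Real.log (2 * ⌈S ^ 50⌉₊ + 1) + Real.log N := by
    calc Real.log n ≤ Real.log ((2 * ⌈S ^ 50⌉₊ + 1) ^ (d + 1) * N) :=
          Real.log_le_log (by exact_mod_cast hn0) (by exact_mod_cast hn)
      _ = _ := by
          rw [Real.log_mul (by positivity) (by exact_mod_cast hN0), Real.log_pow]
          push_cast
          ring
  have h50 : 1 ≤ S ^ 50 := one_le_pow₀ hS1
  have h2 : Real.log (2 * ⌈S ^ 50⌉₊ + 1) ≤ 51 * Real.log S := by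
    have : 51 * Real.log S = Real.log (S ^ 51) := by rw [Real.log_pow]; norm_num
    rw [this]
    refine Real.log_le_log (by positivity) ?_
    have := (Nat.ceil_lt_add_one (show 0 ≤ S ^ 50 by positivity)).le
    calc (2 * (⌈S ^ 50⌉₊ : ℝ) + 1) ≤ 20 * S ^ 50 := by linarith
      _ ≤ S * S ^ 50 := by gcongr
      _ = S ^ 51 := by ring
  have h3 : Real.log (1 + 2 * R / (S ^ 42)⁻¹) ≤ 44 * Real.log S := by
    have : 44 * Real.log S = Real.log (S ^ 44) := by rw [Real.log_pow]; norm_num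
    rw [this, div_inv_eq_mul]
    refine Real.log_le_log (by positivity) ?_
    have h43 : 1 ≤ S ^ 43 := one_le_pow₀ hS1
    calc 1 + 2 * R * S ^ 42 ≤ S ^ 43 + 2 * S * S ^ 42 := by gcongr
      _ ≤ 20 * S ^ 43 := by nlinarith
      _ ≤ S * S ^ 43 := by gcongr
      _ = S ^ 44 := by ring
  -- `d ≥ 1` lets `51 (d + 1)` be absorbed into `102 d`.
  have hd' : (1 : ℝ) ≤ d := by exact_mod_cast hd
  calc Real.log n ≤ (d + 1) * (51 * Real.log S) + p * (44 * Real.log S) := by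
        refine h1.trans (add_le_add (by gcongr) (hN.trans (by gcongr)))
    _ ≤ _ := by
        have : 0 ≤ (p : ℝ) * Real.log S := by positivity
        nlinarith [mul_nonneg (sub_nonneg.2 hd') hlS]

/-- Passing from a point of the net to arbitrary parameters, in a single round. -/
theorem psi_response_le {d d' : ℕ} (κ : Measure (EuclideanSpace ℝ (Fin d') × ℝ))
    [IsProbabilityMeasure κ] {S ρ : ℝ} (hS : 20 ≤ S) (hρ0 : 0 ≤ ρ) (hρ1 : S ^ 4 * ρ ≤ 1)
    {u x θ θ' a a' : EuclideanSpace ℝ (Fin d)} {f f' : EuclideanSpace ℝ (Fin d') → ℝ}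
    {b b' v βu H βη : ℝ} {z₀ : EuclideanSpace ℝ (Fin d') × ℝ}
    (hK : βu + H + βη ≤ S ^ 3) (hf : Measurable f) (hf' : Measurable f') (hfH : ∀ x, |f x| ≤ H)
    (hfH' : ∀ x, |f' x| ≤ H) (hff : ∀ x, ‖x‖ ≤ 1 → |f x - f' x| ≤ ρ) (hx : ‖x‖ ≤ 1)
    (hu : ‖u‖ ≤ βu) (hz₀ : ‖z₀.1‖ ≤ 1 ∧ |z₀.2| ≤ βη) (hz : ∀ᵐ z ∂κ, ‖z.1‖ ≤ 1 ∧ |z.2| ≤ βη)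
    (hv : 0 < v) (hvS : v⁻¹ ≤ S) (hV : ∫ z, response u f x z ^ 2 ∂κ ≤ 1 / 2 * v)
    (ha : ‖a‖ ≤ S ^ 8) (hb : |b| ≤ S ^ 8) (haa : ‖a - a'‖ ≤ S * ρ) (hbb : |b - b'| ≤ ρ)
    (hθ : ‖θ‖ ≤ S ^ 9) (hθθ : ‖θ - θ'‖ ≤ S * ρ) :
    psi (v⁻¹ * inner ℝ a x * response u f x z₀ - b)
      ≤ (psi (v⁻¹ * inner ℝ a' x * response u f' x z₀ - b')
        - compensator (v⁻¹ * inner ℝ a' x) b' (inner ℝ x θ') (∫ z, response u f' x z ^ 2 ∂κ))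
        + meanBound v⁻¹ (inner ℝ a x) (inner ℝ x θ) b + 20 * (S ^ 9) ^ 4 * (S ^ 4 * ρ) := by
  have hS0 : 0 < S := by linarith
  have hS1 : 1 ≤ S := by linarith
  have hρξ : ρ ≤ S ^ 4 * ρ := le_mul_of_one_le_left hρ0 (one_le_pow₀ hS1)
  have hSρξ : S * ρ ≤ S ^ 4 * ρ := by
    gcongr; exact le_self_pow₀ hS1 (by norm_num)
  have hS9 : S ^ 8 + 1 ≤ S ^ 9 := by
    have := one_le_pow₀ hS1 (n := 8)
    nlinarith
  have hdiff : ∀ z : EuclideanSpace ℝ (Fin d') × ℝ, ‖z.1‖ ≤ 1 →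
      |response u f x z - response u f' x z| ≤ ρ := by
    intro z hz
    have : response u f x z - response u f' x z = f z.1 - f' z.1 := by unfold response; ring
    rw [this]
    exact hff _ hz
  have hV' := integral_sq_le_of_perturbation κ
    (measurable_response_right u x hf) (measurable_response_right u x hf') (ε := ρ)
    (by filter_upwards [hz] with z hz using abs_response_le hx hu (hfH _) hz.2)
    (by filter_upwards [hz] with z hz using abs_response_le hx hu (hfH' _) hz.2)
    (by filter_upwards [hz] with z hz using hdiff z hz.1)
  have hVξ : 2 * (βu + H + βη) * ρ ≤ S ^ 4 * ρ := by
    refine mul_le_mul_of_nonneg_right ?_ hρ0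
    calc 2 * (βu + H + βη) ≤ 2 * S ^ 3 := by linarith
      _ ≤ S * S ^ 3 := by gcongr; linarith
      _ = S ^ 4 := by ring
  have hinner : ∀ w w' : EuclideanSpace ℝ (Fin d), ‖w - w'‖ ≤ S * ρ →
      |(inner ℝ w x : ℝ) - inner ℝ w' x| ≤ S ^ 4 * ρ := fun w w' hw => by
    rw [← inner_sub_left]
    exact (abs_inner_le_of_norm_le_one _ _ hx).trans (hw.trans hSρξ)
  -- `S ^ 9` bounds `θ` and the box of radius `S ^ 8` enlarged by the net error. `S ^ 4 * ρ`
  -- dominates all perturbations, including the shift `2 (βu + H + βη) ρ` of the second moment.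
  refine psi_le_of_perturbation (B := S ^ 9) (ξ := S ^ 4 * ρ) (v := v)
    (one_le_pow₀ hS1) (inv_nonneg.2 hv.le) ?_ (inv_mul_cancel₀ hv.ne') ?_ ?_ ?_ ?_ ?_ ?_
    (hinner _ _ haa) ?_ (hbb.trans hρξ) ((hdiff _ hz₀.1).trans hρξ)
    (hV'.trans (add_le_add hV hVξ))
  · exact hvS.trans (le_self_pow₀ hS1 (by norm_num))
  · exact (abs_inner_le_of_norm_le_one _ _ hx).trans (by linarith)
  · refine (abs_inner_le_of_norm_le_one _ _ hx).trans ?_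
    have := norm_sub_norm_le a' a
    rw [norm_sub_rev] at this
    linarith
  · rw [real_inner_comm]
    exact (abs_inner_le_of_norm_le_one _ _ hx).trans hθ
  · linarith
  · have := abs_sub_abs_le_abs_sub b' b
    rw [abs_sub_comm] at this
    linarith
  · exact (abs_response_le hx hu (hfH _) hz₀.2).trans
      (hK.trans (pow_le_pow_right₀ hS1 (by norm_num)))
  · rw [real_inner_comm θ, real_inner_comm θ']
    exact hinner _ _ hθθ

section Regression

variable {Ω : Type*} {mΩ : MeasurableSpace Ω} {P : Measure Ω} [IsProbabilityMeasure P]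
  {ℱ : Filtration ℕ mΩ} {d d' p T : ℕ} {H βu βμ βη σmin R : ℝ}
  {φ : Fin T → Ω → EuclideanSpace ℝ (Fin d)} {φ' : Fin T → Ω → EuclideanSpace ℝ (Fin d')}
  {y η σ : Fin T → Ω → ℝ} {μ : Fin d → SignedMeasure (UnitBall d')}
  {ustar : EuclideanSpace ℝ (Fin d)} {F : Set (EuclideanSpace ℝ (Fin d') → ℝ)}
  {fstar : Ω → EuclideanSpace ℝ (Fin d') → ℝ}

/-- Passing from a net to all parameters, at a fixed outcome. -/
theorem IsRegression.sum_psi_le_of_net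
    (h : IsRegression P ℱ p H βu βμ βη σmin R φ φ' y η σ μ ustar F fstar)
    (hσ : 0 < σmin) (hH : 0 ≤ H) {S : ℝ} (hS : 20 ≤ S) (hT : T ≤ S) (hd : d ≤ S)
    (hσS : (σmin ^ 2)⁻¹ ≤ S) (hμS : βμ ≤ S) (huS : βu ≤ S) (hηS : βη ≤ S) (hHS : H ≤ S)
    {ω : Ω} {ℓ : ℝ} (k1 : ∀ t, ‖φ t ω‖ ≤ 1) (k2 : ∀ t, ‖φ' t ω‖ ≤ 1) (k3 : ∀ t, |η t ω| ≤ βη)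
    (k4 : ∀ t, σmin ≤ σ t ω)
    (k5 : ∀ t : Fin T, ∫ z, response ustar (fstar ω) (φ t ω) z ^ 2
      ∂(condLaw (ℱ (t : ℕ)) P (fun ω' => (φ' t ω', η t ω')) ω) ≤ 1 / 2 * (σ t ω) ^ 2)
    (k6 : ∀ t : Fin T, ∀ᵐ z ∂(condLaw (ℱ (t : ℕ)) P (fun ω' => (φ' t ω', η t ω')) ω),
      ‖z.1‖ ≤ 1 ∧ |z.2| ≤ βη)
    {f : EuclideanSpace ℝ (Fin d') → ℝ} (hf : f ∈ F)
    (hff : ∀ x, ‖x‖ ≤ 1 → |fstar ω x - f x| ≤ (S ^ 42)⁻¹)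
    {a a' : EuclideanSpace ℝ (Fin d)} {b b' : ℝ} (ha : ‖a‖ ≤ S ^ 8) (hb : |b| ≤ S ^ 8)
    (haa : ‖a - a'‖ ≤ d * (S ^ 42)⁻¹) (hbb : |b - b'| ≤ (S ^ 42)⁻¹)
    (hW : logSupermartingale P ℱ φ φ' η σ μ ustar f a' b' ω ≤ ℓ) :
    ∑ t, psi (((σ t ω) ^ 2)⁻¹ * inner ℝ a (φ t ω)
        * response ustar (fstar ω) (φ t ω) (φ' t ω, η t ω) - b)
      ≤ ℓ + 1 + ∑ t, meanBound ((σ t ω) ^ 2)⁻¹ (inner ℝ a (φ t ω))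
        (inner ℝ (φ t ω) (ustar + vecIntegral μ (fstar ω))) b := by
  have hS0 : 0 < S := by linarith
  have hS1 : 1 ≤ S := by linarith
  have hmono : ∀ {i j : ℕ}, i ≤ j → S ^ i ≤ S ^ j := fun hij => pow_le_pow_right₀ hS1 hij
  set ρ := (S ^ 42)⁻¹ with hρ
  have hρ0 : 0 < ρ := by positivity
  have hξ : S ^ 4 * ρ = (S ^ 38)⁻¹ := by rw [hρ]; field_simp
  have hξ1 : S ^ 4 * ρ ≤ 1 := by
    rw [hξ]; exact inv_le_one_of_one_le₀ (one_le_pow₀ hS1)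
  have hfm := h.class_measurable f hf
  have hfH := h.class_bounded f hf
  have hsm := h.class_measurable _ (h.fstar_mem ω)
  have hsH := h.class_bounded _ (h.fstar_mem ω)
  have hSS : 20 * S ≤ S ^ 2 := by nlinarith
  have hS23 : S ^ 2 ≤ S ^ 3 := hmono (by norm_num)
  have hK3 : βu + H + βη ≤ S ^ 3 := by linarith
  have hθ : ‖ustar + vecIntegral μ (fstar ω)‖ ≤ S ^ 9 := by
    have h1 := norm_vecIntegral_le μ hsm hH hsH
    have h2 : H * ‖totalMass μ‖ ≤ S * S := mul_le_mul hHS (h.totalMass_le.trans hμS)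
      (norm_nonneg _) hS0.le
    have h3 := (norm_add_le ustar (vecIntegral μ (fstar ω)))
    have h4 := h.norm_ustar_le
    have h5 : S + S * S ≤ S ^ 3 := by nlinarith [mul_le_mul_of_nonneg_right hS (sq_nonneg S)]
    linarith [hmono (show 3 ≤ 9 by norm_num)]
  have hθθ : ‖(ustar + vecIntegral μ (fstar ω)) - (ustar + vecIntegral μ f)‖ ≤ S * ρ := by
    rw [add_sub_add_left_eq_sub]
    refine (norm_vecIntegral_sub_le μ hsm hfm hρ0.le hsH hfH hff).trans ?_
    rw [mul_comm S]
    exact mul_le_mul_of_nonneg_left (h.totalMass_le.trans hμS) hρ0.le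
  have hstep : ∀ t : Fin T, psi (((σ t ω) ^ 2)⁻¹ * inner ℝ a (φ t ω)
        * response ustar (fstar ω) (φ t ω) (φ' t ω, η t ω) - b)
      ≤ (psi (((σ t ω) ^ 2)⁻¹ * inner ℝ a' (φ t ω)
        * response ustar f (φ t ω) (φ' t ω, η t ω) - b')
        - compensator (((σ t ω) ^ 2)⁻¹ * inner ℝ a' (φ t ω)) b'
        (inner ℝ (φ t ω) (ustar + vecIntegral μ f))
        (∫ z, response ustar f (φ t ω) z ^ 2
          ∂(condLaw (ℱ (t : ℕ)) P (fun ω' => (φ' t ω', η t ω')) ω)))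
        + meanBound ((σ t ω) ^ 2)⁻¹ (inner ℝ a (φ t ω))
        (inner ℝ (φ t ω) (ustar + vecIntegral μ (fstar ω))) b
        + 20 * (S ^ 9) ^ 4 * (S ^ 4 * ρ) := by
    intro t
    have hσt : 0 < σ t ω := hσ.trans_le (k4 t)
    refine psi_response_le _ hS hρ0.le hξ1 hK3 hsm hfm hsH hfH hff (k1 t) h.norm_ustar_le
      ⟨k2 t, k3 t⟩ (k6 t) (by positivity) ?_ (k5 t) ha hb (haa.trans ?_) hbb hθ hθθ
    · exact le_trans (by gcongr; exact k4 t) hσS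
    · gcongr
  refine (Finset.sum_le_sum fun t _ => hstep t).trans ?_
  rw [Finset.sum_add_distrib, Finset.sum_add_distrib, Finset.sum_const, Finset.card_univ,
    Fintype.card_fin, nsmul_eq_mul, hξ]
  -- Each round loses `20 S³⁶ S⁴ S⁻⁴² = 20 S⁻²`, and both `T` and `20` are at most `S`; this fixes
  -- the exponent 42.
  have herr : T * (20 * (S ^ 9) ^ 4 * (S ^ 38)⁻¹) ≤ 1 := by
    calc T * (20 * (S ^ 9) ^ 4 * (S ^ 38)⁻¹) ≤ S * (S * (S ^ 9) ^ 4 * (S ^ 38)⁻¹) := by gcongr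
      _ = 1 := by field_simp
  unfold logSupermartingale at hW
  linarith

/-- Nothing makes `fstar` measurable, so events involving it need not be; the exceptional set is
enlarged to a measurable hull. -/
theorem exists_measurableSet_of_measure_le {α : Type*} {mα : MeasurableSpace α} (ν : Measure α)
    [IsProbabilityMeasure ν] {s : Set α} {q : α → Prop} {δ : ℝ} (hδ : 0 ≤ δ)
    (hs : ν s ≤ ENNReal.ofReal δ) (hq : ∀ᵐ x ∂ν, q x) :
    ∃ A, MeasurableSet A ∧ 1 - δ ≤ ν.real A ∧ ∀ x ∈ A, x ∉ s ∧ q x := by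
  refine ⟨(toMeasurable ν (s ∪ {x | ¬ q x}))ᶜ, (measurableSet_toMeasurable _ _).compl, ?_, ?_⟩
  · rw [measureReal_compl (measurableSet_toMeasurable _ _), probReal_univ]
    gcongr
    refine ENNReal.toReal_le_of_le_ofReal hδ ?_
    rw [measure_toMeasurable]
    refine (measure_union_le _ _).trans ?_
    rw [ae_iff.1 hq, add_zero]
    exact hs
  · intro x hx
    have hx' : x ∉ s ∪ {x | ¬ q x} := fun h => hx (subset_toMeasurable _ _ h)
    simpa [not_or] using hx'

/-- With probability `1 - δ`, the sum of influences is controlled uniformly in the parameters. -/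
theorem IsRegression.exists_uniform_bound
    (h : IsRegression P ℱ p H βu βμ βη σmin R φ φ' y η σ μ ustar F fstar)
    (hσ : 0 < σmin) (hH : 0 ≤ H) (hR : 0 ≤ R) {S δ : ℝ} (hδ : 0 < δ) (hS : 20 ≤ S)
    (hT : T ≤ S) (hd : d ≤ S) (hd1 : 1 ≤ d)
    (hσS : (σmin ^ 2)⁻¹ ≤ S) (hμS : βμ ≤ S) (huS : βu ≤ S) (hηS : βη ≤ S) (hRS : R ≤ S)
    (hHS : H ≤ S) :
    ∃ A : Set Ω, MeasurableSet A ∧ 1 - δ ≤ P.real A ∧ ∀ ω ∈ A,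
      (∀ t, ‖φ t ω‖ ≤ 1) ∧ (∀ t, σmin ≤ σ t ω) ∧
      ∀ (a : EuclideanSpace ℝ (Fin d)) (b : ℝ), ‖a‖ ≤ S ^ 8 → |b| ≤ S ^ 8 →
        ∑ t, psi (((σ t ω) ^ 2)⁻¹ * inner ℝ a (φ t ω) * y t ω - b)
          ≤ Real.log (1 / δ) + 102 * (p + d) * Real.log S + 1
            + ∑ t, meanBound ((σ t ω) ^ 2)⁻¹ (inner ℝ a (φ t ω))
              (inner ℝ (φ t ω) (ustar + vecIntegral μ (fstar ω))) b := by
  have hS0 : 0 < S := by linarith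
  have hρ0 : 0 < (S ^ 42)⁻¹ := by positivity
  obtain ⟨N, hN, hNlog⟩ := h.covering ⟨(S ^ 42)⁻¹, hρ0.le⟩ hρ0
  obtain ⟨C, hCF, hCN, hC⟩ := exists_finset_cover hN
  obtain ⟨I, hI, hI'⟩ := exists_net d hρ0 ⌈S ^ 50⌉₊
  -- The exponent 50 is `8 + 42`: the radius of the box divided by the mesh of the grid.
  have hM : S ^ 8 ≤ ⌈S ^ 50⌉₊ * (S ^ 42)⁻¹ := by
    calc S ^ 8 = S ^ 50 * (S ^ 42)⁻¹ := by field_simp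
      _ ≤ _ := by gcongr; exact Nat.le_ceil _
  have hbad := measure_exists_lt_le P (I ×ˢ C)
    (fun i => logSupermartingale P ℱ φ φ' η σ μ ustar i.2 i.1.1 i.1.2)
    (fun i hi => h.measurable_logSupermartingale (hCF _ (Finset.mem_product.1 hi).2) _ _)
    (fun i hi => h.lintegral_exp_logSupermartingale_le_one (hCF _ (Finset.mem_product.1 hi).2) _ _)
    hδ
  obtain ⟨A, hA, hAδ, hAω⟩ := exists_measurableSet_of_measure_le P hδ.le hbad
    (h.norm_feature_le.and (h.norm_feature'_le.and (h.noise_le.and (h.sigma_ge.and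
      (h.variance_le.and (h.ae_condLaw_bounded.and h.target_eq))))))
  refine ⟨A, hA, hAδ, fun ω hω => ?_⟩
  obtain ⟨hgood, k1, k2, k3, k4, k5, k6, k7⟩ := hAω ω hω
  have hy : ∀ t, y t ω = response ustar (fstar ω) (φ t ω) (φ' t ω, η t ω) := fun t => by
    rw [k7 t, response, real_inner_comm]
  refine ⟨k1, k4, fun a b ha hb => ?_⟩
  obtain ⟨q, hq, haa, hbb⟩ := hI' a b (ha.trans hM) (hb.trans hM)
  obtain ⟨f, hf, hff⟩ := hC _ (h.fstar_mem ω)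
  have hqf : (q, f) ∈ I ×ˢ C := Finset.mem_product.2 ⟨hq, hf⟩
  have hW : logSupermartingale P ℱ φ φ' η σ μ ustar f q.1 q.2 ω
      ≤ Real.log ((I ×ˢ C).card / δ) :=
    not_lt.1 fun hlt => hgood ⟨(q, f), hqf, hlt⟩
  have hcard : 0 < (I ×ˢ C).card := Finset.card_pos.2 ⟨_, hqf⟩
  have hlog : Real.log ((I ×ˢ C).card / δ)
      ≤ Real.log (1 / δ) + 102 * (p + d) * Real.log S := by
    rw [Real.log_div (by exact_mod_cast hcard.ne') hδ.ne', one_div, Real.log_inv]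
    have := log_card_le hS hR hRS hd1 hNlog
      (n := (I ×ˢ C).card) (by rw [Finset.card_product]; exact Nat.mul_le_mul hI hCN) hcard
    linarith
  simp only [hy]
  exact h.sum_psi_le_of_net hσ hH hS hT hd hσS hμS huS hηS hHS k1 k2 k3 k4 k5 k6
    (hCF f hf) hff ha hb haa hbb (hW.trans hlog)

end Regression

/-! ### The error bound at a fixed outcome -/

/-- With `b = m + x` and `x = 3L/T`, the terms `-2bTm + Tb²` equal `Tx² - Tm²`. What remains is at
most `-3L + L/2 + 3L/2`, using `x ≤ 1/2`; the mean itself enters only with a favourable sign. -/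
theorem sum_meanBound_le {T : ℕ} {L : ℝ} (hT : 0 < T) (hL : 0 ≤ L) (hLT : 6 * L ≤ T)
    (g h e : Fin T → ℝ) (hQ : ∑ t, g t * h t ^ 2 ≤ L) :
    ∑ t, meanBound (g t) (h t) (e t) ((∑ t, g t * h t * e t) / T + 3 * L / T) ≤ -L := by
  have hT' : (0 : ℝ) < T := by exact_mod_cast hT
  set m := (∑ t, g t * h t * e t) / T with hm
  have hmT : ∑ t, g t * h t * e t = T * m := by rw [hm]; field_simp
  set x := 3 * L / T with hx
  have hxT : T * x = 3 * L := by rw [hx]; field_simp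
  have hx1 : x ≤ 1 / 2 := by rw [hx, div_le_iff₀ hT']; linarith
  have hx0 : 0 ≤ x := by positivity
  have key : ∀ b : ℝ, ∑ t, meanBound (g t) (h t) (e t) b
      = T * m - T * b + (1 / 2 * ∑ t, g t * h t ^ 2 - 2 * b * (T * m) + T * b ^ 2) := by
    intro b
    unfold meanBound
    rw [Finset.sum_add_distrib, Finset.sum_sub_distrib, Finset.sum_add_distrib,
      Finset.sum_sub_distrib, ← Finset.mul_sum, ← Finset.mul_sum, hmT]
    simp only [Finset.sum_const, Finset.card_univ, Fintype.card_fin, nsmul_eq_mul]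
  rw [key]
  have h1 : T * x * x ≤ 3 * L * (1 / 2) := by rw [hxT]; gcongr
  have h2 : 0 ≤ T * m ^ 2 := by positivity
  nlinarith

/-- Purely deterministic: `hbound` is applied at `a = ±α w`, and the norm bound on `a` confines
these data-dependent points to a box fixed in advance. -/
theorem abs_catoniDir_sub_le {d T : ℕ} {lam αmax L : ℝ} (hT : 0 < T) (hlam : 0 < lam)
    (hα : 0 < αmax) (hL : 0 < L) (φ : Fin T → EuclideanSpace ℝ (Fin d)) (y σ : Fin T → ℝ)
    (θ v : EuclideanSpace ℝ (Fin d)) (hv : ‖v‖ ≤ 1)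
    (hbound : ∀ a : EuclideanSpace ℝ (Fin d), ‖a‖ ≤ αmax * (T * lam⁻¹) →
      ∑ t, ((σ t) ^ 2)⁻¹ * inner ℝ a (φ t) ^ 2 ≤ L →
      ∑ t, psi (((σ t) ^ 2)⁻¹ * inner ℝ a (φ t) * y t
        - ((∑ t, ((σ t) ^ 2)⁻¹ * inner ℝ a (φ t) * inner ℝ (φ t) θ) / T + 3 * L / T)) ≤ 0) :
    |catoniDir φ y σ (catoniParam (sigmaMatrix φ σ) L αmax (direction lam φ σ v))
        (direction lam φ σ v) - inner ℝ v θ|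
      ≤ 3 * weightedNorm (lambdaMatrix lam φ σ)⁻¹ v * √L
        + weightedNorm (lambdaMatrix lam φ σ)⁻¹ v * (√lam * ‖θ‖) + 3 * L / (αmax * T) := by
  have hT' : (0 : ℝ) < T := by exact_mod_cast hT
  obtain ⟨x, hw, hn, hxv, hθ⟩ := exists_lambdaMatrix_inv hlam φ σ v
  rw [hw]
  set n := weightedNorm (lambdaMatrix lam φ σ)⁻¹ v
  have hn0 : 0 ≤ n := Real.sqrt_nonneg _
  set w := (T : ℝ) • x with hwx
  set α := catoniParam (sigmaMatrix φ σ) L αmax w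
  have hα0 : 0 < α := catoniParam_pos _ hL hα w
  have hααmax : α ≤ αmax := catoniParam_le _ _ _ w
  have hαw : α ^ 2 * weightedNorm (sigmaMatrix φ σ) w ^ 2 ≤ L :=
    catoniParam_sq_mul_le (sigmaMatrix φ σ) hL hα w
  rw [weightedNorm_sigmaMatrix_sq] at hαw
  have hαdiv : L / α ≤ √L * weightedNorm (sigmaMatrix φ σ) w + L / αmax :=
    div_catoniParam_le (sigmaMatrix φ σ) hL hα w
  have hsum0 : 0 ≤ ∑ t, ((σ t) ^ 2)⁻¹ * inner ℝ x (φ t) ^ 2 :=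
    Finset.sum_nonneg fun t _ => by positivity
  have hwn : weightedNorm (sigmaMatrix φ σ) w ≤ T * n := by
    refine abs_le_of_sq_le_sq' ?_ (by positivity) |>.2
    rw [weightedNorm_sigmaMatrix_sq, mul_pow, hn]
    have : ∑ t, ((σ t) ^ 2)⁻¹ * inner ℝ w (φ t) ^ 2
        = (T : ℝ) ^ 2 * ∑ t, ((σ t) ^ 2)⁻¹ * inner ℝ x (φ t) ^ 2 := by
      rw [Finset.mul_sum]
      refine Finset.sum_congr rfl fun t _ => ?_
      rw [hwx, real_inner_smul_left]
      ring
    rw [this]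
    gcongr
    have : 0 ≤ lam * ‖x‖ ^ 2 := by positivity
    linarith
  have hxn : lam * ‖x‖ ≤ √lam * n := by
    refine abs_le_of_sq_le_sq' ?_ (by positivity) |>.2
    rw [mul_pow, mul_pow, Real.sq_sqrt hlam.le, hn]
    nlinarith
  have hwnorm : ‖w‖ ≤ T * lam⁻¹ := by
    rw [hwx, norm_smul, Real.norm_of_nonneg hT'.le]
    gcongr
    rw [← one_div, le_div_iff₀ hlam]
    linarith
  set m := (∑ t, ((σ t) ^ 2)⁻¹ * inner ℝ x (φ t) * inner ℝ (φ t) θ) with hm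
  have hmv : |m - inner ℝ v θ| ≤ n * (√lam * ‖θ‖) := by
    -- The ridge bias, from `v = Λ x` with `Λ = λ I + Σ`.
    have h1 : m - inner ℝ v θ = -(lam * inner ℝ x θ) := by rw [hθ θ]; ring
    rw [h1, abs_neg, abs_mul, abs_of_pos hlam]
    calc lam * |inner ℝ x θ| ≤ lam * (‖x‖ * ‖θ‖) := by
          gcongr; exact abs_real_inner_le_norm _ _
      _ = lam * ‖x‖ * ‖θ‖ := by ring
      _ ≤ √lam * n * ‖θ‖ := by gcongr
      _ = _ := by ring
  have hsums : ∀ β : ℝ, (∑ t, ((σ t) ^ 2)⁻¹ * inner ℝ (β • w) (φ t) * inner ℝ (φ t) θ) / T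
      = β * m := by
    intro β
    rw [div_eq_iff hT'.ne', hm, Finset.mul_sum, Finset.sum_mul]
    refine Finset.sum_congr rfl fun t _ => ?_
    rw [hwx, real_inner_smul_left, real_inner_smul_left]
    ring
  have happ : ∀ β : ℝ, |β| = α →
      ∑ t, psi (((σ t) ^ 2)⁻¹ * inner ℝ (β • w) (φ t) * y t - (β * m + 3 * L / T)) ≤ 0 := by
    intro β hβ
    rw [← hsums β]
    refine hbound _ ?_ ?_
    · rw [norm_smul, Real.norm_eq_abs, hβ]
      gcongr
    · refine le_trans (le_of_eq ?_) hαw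
      rw [Finset.mul_sum]
      refine Finset.sum_congr rfl fun t _ => ?_
      rw [real_inner_smul_left, ← hβ, sq_abs]
      ring
  have hupper : catoniDir φ y σ α w ≤ m + 3 * L / (α * T) := by
    refine catoni_le hT _ hα0 (le_trans (le_of_eq ?_) (happ α (abs_of_pos hα0)))
    refine Finset.sum_congr rfl fun t _ => ?_
    rw [real_inner_smul_left w (φ t) α]
    congr 1
    field_simp
  have hlower : m - 3 * L / (α * T) ≤ catoniDir φ y σ α w := by
    refine le_catoni hT _ hα0 (le_trans (le_of_eq ?_) (happ (-α) (by rw [abs_neg, abs_of_pos hα0])))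
    refine Finset.sum_congr rfl fun t _ => ?_
    rw [real_inner_smul_left w (φ t) (-α)]
    congr 1
    field_simp
    ring
  have hrad : 3 * L / (α * T) ≤ 3 * n * √L + 3 * L / (αmax * T) := by
    calc 3 * L / (α * T) = 3 / T * (L / α) := by field_simp
      _ ≤ 3 / T * (√L * (T * n) + L / αmax) := by
          gcongr
          exact hαdiv.trans (by gcongr)
      _ = _ := by field_simp
  have h1 : |catoniDir φ y σ α w - m| ≤ 3 * n * √L + 3 * L / (αmax * T) := by
    rw [abs_le]; constructor <;> linarith
  have h2 := abs_sub_le (catoniDir φ y σ α w) m (inner ℝ v θ)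
  linarith

/-! ### The effective dimension -/

theorem one_le_log_exp_one_add {x : ℝ} (hx : 0 ≤ x) : 1 ≤ Real.log (Real.exp 1 + x) := by
  rw [Real.le_log_iff_exp_le (by positivity)]
  linarith

theorem length_le_logs {xs : List ℝ} (h : ∀ x ∈ xs, 0 ≤ x) : (xs.length : ℝ) ≤ logs xs := by
  induction xs with
  | nil => simp [logs]
  | cons x xs ih =>
    have h1 := ih fun y hy => h y (List.mem_cons_of_mem _ hy)
    have h2 := one_le_log_exp_one_add (h x List.mem_cons_self)
    simp only [logs, List.map_cons, List.sum_cons, List.length_cons] at h1 ⊢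
    push_cast
    linarith

/-- All logarithms in `logs` are nonnegative, so `S = exp (logs …)` dominates every problem
parameter at once; all later scales are powers of `S`. -/
theorem le_exp_logs {xs : List ℝ} (h : ∀ x ∈ xs, 0 ≤ x) {x : ℝ} (hx : x ∈ xs) :
    1 + x ≤ Real.exp (logs xs) := by
  have h1 : Real.log (Real.exp 1 + x) ≤ logs xs := by
    refine List.single_le_sum ?_ _ (List.mem_map_of_mem hx)
    intro r hr
    obtain ⟨x', hx', rfl⟩ := List.mem_map.1 hr
    exact zero_le_one.trans (one_le_log_exp_one_add (h x' hx'))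
  have hx0 := h x hx
  rw [Real.log_le_iff_le_exp (by positivity)] at h1
  have := Real.add_one_le_exp (1 : ℝ)
  linarith

theorem abs_add_le_pow {S m L T : ℝ} (hS : 20 ≤ S) (hT : 0 < T) (hL : 0 ≤ L) (hLT : 6 * L ≤ T)
    (hm : |m| ≤ S ^ 7) : |m + 3 * L / T| ≤ S ^ 8 := by
  refine (abs_add_le _ _).trans ?_
  have h1 : |3 * L / T| ≤ 1 := by
    rw [abs_of_nonneg (by positivity), div_le_one hT]
    linarith
  have h2 : 1 ≤ S ^ 7 := one_le_pow₀ (by linarith)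
  calc |m| + |3 * L / T| ≤ 20 * S ^ 7 := by linarith
    _ ≤ S * S ^ 7 := by gcongr
    _ = S ^ 8 := by ring

theorem abs_sum_div_le {T : ℕ} (hT : 0 < T) (z : Fin T → ℝ) {B : ℝ} (hz : ∀ t, |z t| ≤ B) :
    |(∑ t, z t) / T| ≤ B := by
  have hT' : (0 : ℝ) < T := by exact_mod_cast hT
  rw [abs_div, abs_of_pos hT', div_le_iff₀ hT']
  calc |∑ t, z t| ≤ ∑ t, |z t| := Finset.abs_sum_le_sum_abs _ _
    _ ≤ ∑ _t : Fin T, B := Finset.sum_le_sum fun t _ => hz t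
    _ = B * T := by simp [mul_comm]

/-- The uniform bound on the sum of influences at a fixed outcome gives the error bound for the
estimator in every direction. -/
theorem abs_catoniDir_sub_le_of_uniform_bound {d T : ℕ} {lam αmax L ℓ S : ℝ} (hT : 0 < T)
    (hlam : 0 < lam) (hα : 0 < αmax) (hL : 0 < L) (hLT : 6 * L ≤ T) (hℓ : ℓ + 1 ≤ L) (hS : 20 ≤ S)
    (hTS : T ≤ S) (hαS : αmax ≤ S) (hlamS : lam⁻¹ ≤ S)
    (φ : Fin T → EuclideanSpace ℝ (Fin d)) (y σ : Fin T → ℝ) (θ v : EuclideanSpace ℝ (Fin d))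
    (hv : ‖v‖ ≤ 1) (hφ : ∀ t, ‖φ t‖ ≤ 1) (hσ : ∀ t, ((σ t) ^ 2)⁻¹ ≤ S) (hθ : ‖θ‖ ≤ S ^ 3)
    (hu : ∀ (a : EuclideanSpace ℝ (Fin d)) (b : ℝ), ‖a‖ ≤ S ^ 8 → |b| ≤ S ^ 8 →
      ∑ t, psi (((σ t) ^ 2)⁻¹ * inner ℝ a (φ t) * y t - b)
        ≤ ℓ + 1 + ∑ t, meanBound ((σ t) ^ 2)⁻¹ (inner ℝ a (φ t)) (inner ℝ (φ t) θ) b) :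
    |catoniDir φ y σ (catoniParam (sigmaMatrix φ σ) L αmax (direction lam φ σ v))
        (direction lam φ σ v) - inner ℝ v θ|
      ≤ 5 * weightedNorm (lambdaMatrix lam φ σ)⁻¹ v * (√L + √lam * ‖θ‖)
        + 3 * L / (αmax * T) := by
  have hT' : (0 : ℝ) < T := by exact_mod_cast hT
  have hS1 : 1 ≤ S := by linarith
  have hn0 : 0 ≤ weightedNorm (lambdaMatrix lam φ σ)⁻¹ v := Real.sqrt_nonneg _
  refine (abs_catoniDir_sub_le hT hlam hα hL φ y σ θ v hv fun a ha hQ => ?_).trans ?_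
  · have ha3 : ‖a‖ ≤ S ^ 3 := by
      calc ‖a‖ ≤ αmax * (T * lam⁻¹) := ha
        _ ≤ S * (S * S) := by gcongr
        _ = S ^ 3 := by ring
    -- Size bookkeeping: `‖a‖ ≤ S³`, `σₜ⁻² ≤ S` and `‖θ‖ ≤ S³` give `|m| ≤ S⁷`, so `b` stays in the
    -- box of radius `S⁸`.
    have hm := abs_sum_div_le hT
      (fun t => ((σ t) ^ 2)⁻¹ * inner ℝ a (φ t) * inner ℝ (φ t) θ) (B := S ^ 7) fun t => by
        rw [abs_mul, abs_mul, abs_of_nonneg (by positivity), real_inner_comm θ]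
        calc _ ≤ S * S ^ 3 * S ^ 3 := by
              gcongr
              · exact hσ t
              · exact (abs_inner_le_of_norm_le_one _ _ (hφ t)).trans ha3
              · exact (abs_inner_le_of_norm_le_one _ _ (hφ t)).trans hθ
          _ = S ^ 7 := by ring
    have h1 := hu a _ (ha3.trans (pow_le_pow_right₀ hS1 (by norm_num)))
      (abs_add_le_pow hS hT' hL.le hLT hm)
    have h2 := sum_meanBound_le hT hL.le hLT (fun t => ((σ t) ^ 2)⁻¹) (fun t => inner ℝ a (φ t))
      (fun t => inner ℝ (φ t) θ) hQ
    linarith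
  · have h1 : 0 ≤ weightedNorm (lambdaMatrix lam φ σ)⁻¹ v * √L := by positivity
    have h2 : 0 ≤ weightedNorm (lambdaMatrix lam φ σ)⁻¹ v * (√lam * ‖θ‖) := by positivity
    nlinarith

end HeteroCatoni

open HeteroCatoni
theorem mainTheorem4 :
    ∃ c : ℝ, 0 < c ∧
      ∀ (Ω : Type*) [mΩ : MeasurableSpace Ω] (P : Measure Ω) [IsProbabilityMeasure P]
        (ℱ : Filtration ℕ mΩ) (d d' p T : ℕ)
        (H βu βμ βη σmin R lam αmax δ : ℝ)
        (φ : Fin T → Ω → EuclideanSpace ℝ (Fin d)) (φ' : Fin T → Ω → EuclideanSpace ℝ (Fin d'))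
        (y η σ : Fin T → Ω → ℝ) (μ : Fin d → SignedMeasure (UnitBall d'))
        (ustar : EuclideanSpace ℝ (Fin d)) (F : Set (EuclideanSpace ℝ (Fin d') → ℝ))
        (fstar : Ω → EuclideanSpace ℝ (Fin d') → ℝ),
        0 ≤ H → 0 ≤ βu → 0 ≤ βμ → 0 ≤ βη → 0 < σmin → 0 < R → 0 < lam → 0 < αmax →
        0 < δ → δ < 1 →
        IsRegression P ℱ p H βu βμ βη σmin R φ φ' y η σ μ ustar F fstar →
        6 * (Real.log (1 / δ) + effDim c p d T αmax lam σmin βμ βu βη R H) ≤ T →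
        ∃ A : Set Ω, MeasurableSet A ∧ 1 - δ ≤ P.real A ∧ ∀ ω ∈ A,
          ∀ v : EuclideanSpace ℝ (Fin d), ‖v‖ ≤ 1 →
            |catoniDir (fun t => φ t ω) (fun t => y t ω) (fun t => σ t ω)
                (catoniParam (sigmaMatrix (fun t => φ t ω) (fun t => σ t ω))
                  (effDim c p d T αmax lam σmin βμ βu βη R H + Real.log (1 / δ)) αmax
                  (direction lam (fun t => φ t ω) (fun t => σ t ω) v))
                (direction lam (fun t => φ t ω) (fun t => σ t ω) v)
              - inner ℝ v (ustar + vecIntegral μ (fstar ω))|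
            ≤ 5 * weightedNorm (lambdaMatrix lam (fun t => φ t ω) (fun t => σ t ω))⁻¹ v *
                  (√(Real.log (1 / δ) + effDim c p d T αmax lam σmin βμ βu βη R H)
                    + √lam * ‖ustar + vecIntegral μ (fstar ω)‖)
              + 3 * (Real.log (1 / δ) + effDim c p d T αmax lam σmin βμ βu βη R H) / (αmax * T) := by
  -- The net costs `102 (p + d) log S` and the perturbation 1; since `log S = logs(…) ≥ 9`, the
  -- constant 200 covers both when `d ≥ 1`.
  refine ⟨200, by norm_num, ?_⟩
  intro Ω mΩ P _ ℱ d d' p T H βu βμ βη σmin R lam αmax δ φ φ' y η σ μ ustar F fstar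
    hH hβu hβμ hβη hσ hR hlam hα hδ hδ1 h hLT
  have hxs : ∀ x ∈ [(T : ℝ), αmax ^ 2, lam⁻¹, (σmin ^ 2)⁻¹, βμ, βu, βη, R, H], 0 ≤ x := by
    simp only [List.forall_mem_cons, List.not_mem_nil, false_implies, implies_true, and_true]
    refine ⟨?_, ?_, ?_, ?_, ?_, ?_, ?_, ?_, ?_⟩ <;> positivity
  have hS := fun x => le_exp_logs hxs (x := x)
  have h9 := length_le_logs hxs
  have hD : effDim 200 p d T αmax lam σmin βμ βu βη R H = 200 * ((p : ℝ) + d) *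
    logs [(T : ℝ), αmax ^ 2, lam⁻¹, (σmin ^ 2)⁻¹, βμ, βu, βη, R, H] := rfl
  set lg := logs [(T : ℝ), αmax ^ 2, lam⁻¹, (σmin ^ 2)⁻¹, βμ, βu, βη, R, H]
  set D := effDim 200 p d T αmax lam σmin βμ βu βη R H
  set S := Real.exp lg
  simp only [List.forall_mem_cons, List.not_mem_nil, false_implies, implies_true, and_true] at hS
  obtain ⟨hTS, hαS, hlamS, hσS, hμS, huS, hηS, hRS, hHS⟩ := hS
  have h9' : 9 ≤ lg := by simpa using h9
  have hS20 : 20 ≤ S := by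
    have := Real.quadratic_le_exp_of_nonneg (show 0 ≤ lg by linarith)
    nlinarith
  have hαS' : αmax ≤ S := by nlinarith [sq_nonneg (αmax - 1)]
  -- `δ < 1` keeps `L`, and hence `T` and the Catoni parameter, positive even when `p = d = 0`.
  have hlogδ : 0 < Real.log (1 / δ) := Real.log_pos (by rw [lt_div_iff₀ hδ]; linarith)
  have hpd : (0 : ℝ) ≤ (p : ℝ) + d := by positivity
  have hDpd : 1800 * ((p : ℝ) + d) ≤ D := by rw [hD]; nlinarith
  set L := Real.log (1 / δ) + D
  have hL : 0 < L := by linarith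
  have hT' : (0 : ℝ) < T := by linarith
  have hT : 0 < T := by exact_mod_cast hT'
  have hθ : ∀ ω, ‖ustar + vecIntegral μ (fstar ω)‖ ≤ S ^ 3 := fun ω => by
    have h1 := norm_vecIntegral_le μ (h.class_measurable _ (h.fstar_mem ω)) hH
      (h.class_bounded _ (h.fstar_mem ω))
    have h2 : H * ‖totalMass μ‖ ≤ S * S :=
      mul_le_mul (by linarith) (by linarith [h.totalMass_le]) (norm_nonneg _) (by linarith)
    have h3 := norm_add_le ustar (vecIntegral μ (fstar ω))
    have h4 := h.norm_ustar_le
    nlinarith [mul_le_mul_of_nonneg_right hS20 (sq_nonneg S)]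
  -- For `d = 0` the `(d + 1)`-dimensional grid is not paid for by `p + d`, but every inner product
  -- vanishes and each influence is `ψ(-3L/T) ≤ 0`.
  rcases Nat.eq_zero_or_pos d with rfl | hd
  · refine ⟨Set.univ, MeasurableSet.univ, by simp [hδ.le], fun ω _ v _ => ?_⟩
    rw [Subsingleton.elim v 0, add_comm D]
    refine (abs_catoniDir_sub_le hT hlam hα hL _ _ _ _ _ (by simp) fun a _ _ => ?_).trans ?_
    · rw [Subsingleton.elim a 0]
      refine Finset.sum_nonpos fun t _ => ?_
      rw [← psi_zero]
      refine psi_strictMono.monotone ?_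
      simp only [inner_zero_left, mul_zero, zero_mul, Finset.sum_const_zero, zero_div, zero_add,
        zero_sub, Left.neg_nonpos_iff]
      positivity
    · have hn : 0 ≤ weightedNorm
          (lambdaMatrix lam (fun t => φ t ω) (fun t => σ t ω))⁻¹ 0 := Real.sqrt_nonneg _
      have h1 := mul_nonneg hn (Real.sqrt_nonneg L)
      have h2 := mul_nonneg hn (mul_nonneg (Real.sqrt_nonneg lam)
        (norm_nonneg (ustar + vecIntegral μ (fstar ω))))
      linarith
  · have hd1 : (1 : ℝ) ≤ d := by exact_mod_cast hd
    have hp0 : (0 : ℝ) ≤ p := by positivity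
    -- The dimension is not an entry of `logs`; `d ≤ S` follows from `1800 d ≤ D ≤ L ≤ T / 6` and `T
    -- ≤ S`.
    obtain ⟨A, hA, hAδ, hAω⟩ := h.exists_uniform_bound hσ hH hR.le hδ hS20 (by linarith)
      (by linarith) hd (by linarith) (by linarith) (by linarith) (by linarith) (by linarith)
      (by linarith)
    refine ⟨A, hA, hAδ, fun ω hω v hv => ?_⟩
    obtain ⟨k1, k2, k4⟩ := hAω ω hω
    rw [add_comm D]
    refine abs_catoniDir_sub_le_of_uniform_bound hT hlam hα hL hLT ?_ hS20 (by linarith) hαS'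
      (by linarith) _ _ _ _ v hv k1 (fun t => ?_) (hθ ω) k4
    · rw [Real.log_exp]
      nlinarith
    · refine le_trans ?_ (show (σmin ^ 2)⁻¹ ≤ S by linarith)
      gcongr
      exact k2 t
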